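/- **Model.** For each $N\ge 1$ consider a discrete-time system of $N$ parallel FIFO queues with infinite buffers. In slot $t$ the dispatcher observes the queue vector $\mathbf Q(t)\in\mathbb Z_{\ge 0}^N$; then $A_\Sigma(t)$ tasks arrive and all join one server chosen by the policy, and $$Q_n(t+1)=\max\big(Q_n(t)+A_n(t)-S_n(t),\,0\big),$$ where $A_n(t)$ is the number of arrivals sent to server $n$ and $S_n(t)$ is the offered service. The pairs $(A_\Sigma(t),(S_n(t))_{n\le N})$ are i.i.d. in $t$, with non-negative integer values; in each slot $A_\Sigma(t)$, the service vector and the dispatching decision are independent given $\mathbf Q(t)$ (the services of different servers may, but need not, be independent of each other). They satisfy $A_\Sigma\le A_{\max}^{(N)}$, $S_n\le S_{\max}$ with $S_{\max}$ independent of $N$, and $P(A_\Sigma=0)>0$. Write $\lambda_\Sigma=E A_\Sigma$, $\mu_n=E S_n$, $\mu_\Sigma=\sum_n\mu_n$, $\sigma_\Sigma^2=\mathrm{Var}(A_\Sigma)$, $\nu_\Sigma^2=\mathrm{Var}(\sum_n S_n)$. Let $\alpha>1$ and assume, as $N\to\infty$, $\lambda_\Sigma=\mu_\Sigma-N^{1-\alpha}$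 (i.e. $\epsilon=N^{1-\alpha}$), $\mu_\Sigma=\Theta(N)$, $A_{\max}=\Theta(N)$. **Policies.** In each slot the servers are ranked from shortest to longest queue (ties broken by a possibly random rule depending on $\mathbf Q(t)$), and the server of rank $n$ is selected with a probability $P_n$ that may depend arbitrarily on $\mathbf Q(t)$ and on the ranking. The dispatching preference is $\Delta_n=P_n-\mu_{(n)}/\mu_\Sigma$, where $\mu_{(n)}$ is the mean service of the server of rank $n$. For $\gamma\in(0,1]$ let $\mathcal K_\gamma\subset\mathbb R^N$ be the cone generated by the vectors $\mathbf b^{(n)}$, $n\le N$, whose $n$-th component is $1$ and whose other components are $\gamma$. The policies are in the flexible class $\Pi_1$: there are constants $\gamma\in(0,1]$ and $c>0$ independent of $N$ such that, for all large $N$ and with $\delta=c/N$, whenever $\mathbf Q(t)\notin\mathcal K_\gamma$ (and for every ranking that the tie-breaking rule can produce) there is $k\in\{2,\dots,N\}$ with $\Delta_n\ge 0$ for $n<k$ and $\Delta_n\le 0$ for $n\ge k$, and $\min(|\Delta_1|,|\Delta_N|)\ge\delta$. **Theorem 1.** Let $\overline{\mathbf Q}^{(N)}$ be distributed according to any stationary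 distribution of the Markov chain $\mathbf Q(t)$ in the $N$-th system. Then for all large $N$ the total queue length $\sum_n\overline Q_n^{(N)}$ has finite mean. Let $d_W(X,Y)=\sup_h|E h(X)-E h(Y)|$ be the Wasserstein distance, the supremum being over 1-Lipschitz $h$. 1. If $\sigma_\Sigma^2=N\sigma_a^2$ and $\nu_\Sigma^2=N\nu_s^2$ for all large $N$, with $\sigma_a,\nu_s$ independent of $N$, and $Z$ is exponential with mean $(\sigma_a^2+\nu_s^2)/2$, then for every real $r\ge 2$, as $N\to\infty$, $$d_W\Big(N^{-\alpha}\sum_{n=1}^N\overline Q_n^{(N)},\,Z\Big)=O\big(N^{4-\alpha+\frac{\alpha-1}{r}}\big).$$ Consequently, if $\alpha>4$, then $N^{-\alpha}\sum_n\overline Q^{(N)}_n$ converges in distribution to $Z$. 2. If $\sigma_\Sigma^2=N^2\tilde\sigma_a^2$ and $\nu_\Sigma^2=N^2\tilde\nu_s^2$ for all large $N$, with $\tilde\sigma_a,\tilde\nu_s$ independent of $N$, and $Z$ is exponential with mean $(\tilde\sigma_a^2+\tilde\nu_s^2)/2$, then for every real $r\ge 2$, as $N\to\infty$, $$d_W\Big(N^{-\alpha-1}\sum_{n=1}^N\overline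 Q_n^{(N)},\,Z\Big)=O\big(N^{3-\alpha+\frac{\alpha-1}{r}}\big).$$ Consequently, if $\alpha>3$, this distance tends to $0$ as $N\to\infty$. -/

import Mathlib

open MeasureTheory ProbabilityTheory Filter Topology Asymptotics
open scoped ENNReal

noncomputable section

namespace LoadBalancing

/-- A load balancing policy for `N` servers.  In state `Q` the servers are first ranked from
shortest to longest queue, ties being broken by the random permutation `tie Q`
(`σ n` is the server holding rank `n`, ranks starting at `0`).  Given the ranking `σ`, the arrivals
are sent to the server of rank `n` with probability `disp Q σ n`: this is the dispatching
distribution.  It may be an arbitrary function of the queue lengths. -/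
structure Policy (N : ℕ) where
  tie : (Fin N → ℕ) → PMF (Equiv.Perm (Fin N))
  sorted : ∀ (Q : Fin N → ℕ), ∀ σ ∈ (tie Q).support, Monotone (Q ∘ σ)
  disp : (Fin N → ℕ) → Equiv.Perm (Fin N) → PMF (Fin N)

/-- A system with `N` servers: the law of the number of tasks arriving in one slot, the joint law
of the services offered by the servers in one slot, and the dispatching policy. -/
structure System (N : ℕ) where
  arr : PMF ℕ
  svc : PMF (Fin N → ℕ)
  pol : Policy N

/-- The queue lengths after one slot in which `a` tasks arrive and join server `j`, and the offered
services are `s`.  The subtraction is the truncated one of `ℕ`. -/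
def nextQueue {N : ℕ} (Q : Fin N → ℕ) (j : Fin N) (a : ℕ) (s : Fin N → ℕ) : Fin N → ℕ :=
  fun i => Q i + (if i = j then a else 0) - s i

/-- `Q(t+1) = Q(t) + A(t) - S(t) + U(t)` with unused service `U = max (S - A - Q) 0`. -/
theorem nextQueue_eq {N : ℕ} (Q : Fin N → ℕ) (j : Fin N) (a : ℕ) (s : Fin N → ℕ) (i : Fin N) :
    (nextQueue Q j a s i : ℤ) =
      (Q i : ℤ) + (if i = j then (a : ℤ) else 0) - (s i : ℤ)
        + max ((s i : ℤ) - (if i = j then (a : ℤ) else 0) - (Q i : ℤ)) 0 := by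
  unfold nextQueue
  split_ifs <;> omega

namespace System

variable {N : ℕ} (sys : System N)

/-- Mean service `μ_n` of server `n` per slot. -/
def mu (n : Fin N) : ℝ := ∫ s, (s n : ℝ) ∂sys.svc.toMeasure

/-- Mean total service `μ_Σ` per slot. -/
def muSum : ℝ := ∑ n, sys.mu n

/-- Mean total arrival `λ_Σ` per slot. -/
def lambdaSum : ℝ := ∫ a, (a : ℝ) ∂sys.arr.toMeasure

/-- Variance of the total arrival in one slot. -/
def arrVar : ℝ := variance (fun a : ℕ => (a : ℝ)) sys.arr.toMeasure

/-- Variance of the total offered service in one slot. -/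
def svcVar : ℝ := variance (fun s : Fin N → ℕ => ∑ n, (s n : ℝ)) sys.svc.toMeasure

/-- One-step transition law of the queue length Markov chain: given the present queue lengths, the
ranking and the dispatching decision, the arrivals and the offered services are independent of each
other and of the decision. -/
def step (Q : Fin N → ℕ) : PMF (Fin N → ℕ) :=
  (sys.pol.tie Q).bind fun σ =>
    (sys.pol.disp Q σ).bind fun n =>
      sys.arr.bind fun a =>
        sys.svc.map fun s => nextQueue Q (σ n) a s

/-- `p` is a stationary distribution (steady state) of the queue length chain. -/
def IsStationary (p : PMF (Fin N → ℕ)) : Prop := p.bind sys.step = p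

/-- The dispatching preference in state `Q` with ranking `σ`: its component `n` is the probability
of selecting the server of rank `n` under the policy, minus the same probability under weighted
random routing, which selects every server with probability proportional to its mean service. -/
def preference (Q : Fin N → ℕ) (σ : Equiv.Perm (Fin N)) (n : Fin N) : ℝ :=
  (sys.pol.disp Q σ n).toReal - sys.mu (σ n) / sys.muSum

end System

/-- The generator `b^(n)` of the cone: component `n` is `1`, all others are `γ`. -/
def coneGen {N : ℕ} (γ : ℝ) (n : Fin N) : Fin N → ℝ := fun i => if i = n then 1 else γ

/-- The cone `K_γ` generated by the vectors `b^(n)`. -/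
def cone (N : ℕ) (γ : ℝ) : Set (Fin N → ℝ) :=
  {x | ∃ w : Fin N → ℝ, (∀ n, 0 ≤ w n) ∧ x = ∑ n, w n • coneGen γ n}

/-- The flexible class: whenever the queue length vector is outside the cone `K_γ`, the preference
is nonnegative on the ranks before some `k` (not the first rank), nonpositive from `k` on, and at
least `δ` in absolute value at the first and at the last rank. -/
def System.InFlexibleClass {N : ℕ} (sys : System N) (γ δ : ℝ) : Prop :=
  ∀ Q : Fin N → ℕ, (fun i => (Q i : ℝ)) ∉ cone N γ →
    ∀ σ ∈ (sys.pol.tie Q).support,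
      (∃ k : Fin N, 0 < (k : ℕ) ∧ (∀ n < k, 0 ≤ sys.preference Q σ n) ∧
        (∀ n, k ≤ n → sys.preference Q σ n ≤ 0)) ∧
      (∀ n : Fin N, ((n : ℕ) = 0 ∨ (n : ℕ) + 1 = N) → δ ≤ |sys.preference Q σ n|)

/-- The law of `N ^ (-β)` times the total queue length, when the queue lengths have law `p`. -/
def scaledTotal {N : ℕ} (β : ℝ) (p : PMF (Fin N → ℕ)) : Measure ℝ :=
  p.toMeasure.map fun Q => (N : ℝ) ^ (-β) * ∑ n, (Q n : ℝ)

/-- Wasserstein distance of two laws on the line (with finite means): supremum over the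
1-Lipschitz functions of the difference of expectations. -/
def wassersteinDist (P P' : Measure ℝ) : ℝ≥0∞ :=
  ⨆ (h : ℝ → ℝ) (_ : LipschitzWith 1 h), ENNReal.ofReal |(∫ x, h x ∂P) - ∫ x, h x ∂P'|

end LoadBalancing

end

/-!
The argument is Stein's method for the exponential law, fed by a state space collapse which holds
only up to the cone `K_γ`.

**Stein's method.** For a 1-Lipschitz `h` and an exponential variable `Z` of rate `ρ`, the function
`f` with `f' x = E h(Z) - E h(x + Z)` and `f 0 = 0` solves `f'' / ρ - f' = h - E h(Z)`; here `f'` is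
1-Lipschitz, vanishes at `0`, and `f''` is `2 ρ`-Lipschitz (`steinDeriv`, `hasDerivAt_steinDeriv`,
`steinSol_taylor_two`). Let `T` be the total queue length, `U` the total unused service, `ε` the
slack capacity and `η` the scaling factor. In steady state the mean of `f (η T)` does not change
in one slot. Expanding `f` along one slot, the terms due to arrivals and offered services give
`η ε (h (η T) - E h(Z))` exactly when `η ρ (σ_Σ² + ν_Σ²) = 2 ε`; what remains are small terms in
`U²`, `ε²` and third moments, and the unused service, which contributes at most `η² E[T⁺ U]`, as
`|f' (η T⁺)| ≤ η T⁺` (`System.Regular.abs_integral_lipschitz_sub_le`).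

**Unused service.** Service is wasted only at a server whose queue becomes empty, while all queues
of a vector in the cone are at least `T` times a constant of order `1 / N`. Hence `T⁺ U` is at most
a constant multiple of `N U` times the Euclidean norm of the deficits of the queues with respect to the cone
(`total_mul_unused_le`). Since `E U = ε` (`System.Regular.integral_meanUnused`), it remains to bound
the moments of the norm of the deficits uniformly in `ε`.

**Collapse to the cone.** Outside the cone, the preference for short queues gives the sum of the
squared deficits a negative drift proportional to the largest deficit, up to a term of order `N²`
(`System.Regular.integral_linearDrift_le`, `coneGap_nextQueue_le`); unused service does no harm,
because it occurs only at servers with nearly maximal deficit. The norm of the deficits thus has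
drift of order `-N ^ (-1 / 2)` above the level `N ^ (5 / 2)`, and jumps of order `N`, so that it has
an exponential moment at the scale `N ^ (5 / 2)` (`System.Regular.integral_exp_gap_le`). No moment
of the given stationary law is known in advance; the drift conditions are turned into moment bounds
by `lintegral_le_of_drift`, which truncates the Lyapunov function. The same theorem, applied to the
cube of `T`, gives a finite second moment of `T`.

**Conclusion.** For a threshold `τ`, `E[T⁺ U]` is at most of the order of
`N (τ ε + N τ ^ (1 - r) N ^ (5 r / 2))`, and `τ = N ^ (5 / 2 + α / r)` gives the stated rate if
`r ≥ 2` (`System.Regular.wassersteinDist_le`).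
-/

noncomputable section

namespace LoadBalancing

/-! ### Expectations under discrete laws, and the comparison theorem for stationary laws -/

section PMFExpectation

variable {α β γ : Type*}

theorem toMeasure_bind_eq_sum [MeasurableSpace β] (p : PMF α) (q : α → PMF β) :
    (p.bind q).toMeasure = Measure.sum fun a => p a • (q a).toMeasure := by
  ext s hs
  rw [PMF.toMeasure_bind_apply _ _ _ hs, Measure.sum_apply _ hs]
  simp

/-- Expectation under a mixture; no measurable structure on the mixing variable is needed. -/
theorem lintegral_pmf_bind [MeasurableSpace β] (p : PMF α) (q : α → PMF β) (f : β → ℝ≥0∞) :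
    ∫⁻ b, f b ∂(p.bind q).toMeasure = ∑' a, p a * ∫⁻ b, f b ∂(q a).toMeasure := by
  rw [toMeasure_bind_eq_sum, lintegral_sum_measure]
  simp

theorem lintegral_pmf_eq_tsum [MeasurableSpace α] [DiscreteMeasurableSpace α] (p : PMF α)
    (f : α → ℝ≥0∞) : ∫⁻ a, f a ∂p.toMeasure = ∑' a, p a * f a := by
  conv_lhs => rw [← PMF.bind_pure p]
  rw [lintegral_pmf_bind]
  refine tsum_congr fun a => ?_
  rw [PMF.toMeasure_pure, lintegral_dirac' _ (Measurable.of_discrete)]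

theorem lintegral_pmf_bind' [MeasurableSpace α] [DiscreteMeasurableSpace α] [MeasurableSpace β]
    (p : PMF α) (q : α → PMF β) (f : β → ℝ≥0∞) :
    ∫⁻ b, f b ∂(p.bind q).toMeasure = ∫⁻ a, ∫⁻ b, f b ∂(q a).toMeasure ∂p.toMeasure := by
  rw [lintegral_pmf_bind, lintegral_pmf_eq_tsum]

theorem hasSum_integral_pmf_bind [MeasurableSpace β] (p : PMF α) (q : α → PMF β) {f : β → ℝ}
    (hf : Integrable f (p.bind q).toMeasure) :
    HasSum (fun a => (p a).toReal * ∫ b, f b ∂(q a).toMeasure)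
      (∫ b, f b ∂(p.bind q).toMeasure) := by
  rw [toMeasure_bind_eq_sum] at hf ⊢
  simpa using hasSum_integral_measure hf

theorem hasSum_toReal_pmf (p : PMF α) : HasSum (fun a => (p a).toReal) 1 := by
  have h := p.tsum_coe
  have h1 : (∑' a, p a) ≠ ∞ := by rw [h]; exact ENNReal.one_ne_top
  have h2 := ENNReal.hasSum_toReal h1
  rwa [← ENNReal.tsum_toReal_eq (fun a => p.apply_ne_top a), h, ENNReal.toReal_one] at h2

/-- A bound on all the conditional expectations bounds the expectation. -/
theorem integral_pmf_bind_le [MeasurableSpace β] (p : PMF α) (q : α → PMF β) {f : β → ℝ}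
    (hf : Integrable f (p.bind q).toMeasure) {c : ℝ}
    (h : ∀ a ∈ p.support, ∫ b, f b ∂(q a).toMeasure ≤ c) :
    ∫ b, f b ∂(p.bind q).toMeasure ≤ c := by
  have h1 := (hasSum_toReal_pmf p).mul_right c
  rw [one_mul] at h1
  refine hasSum_le (fun a => ?_) (hasSum_integral_pmf_bind p q hf) h1
  by_cases ha : p a = 0
  · simp [ha]
  · exact mul_le_mul_of_nonneg_left (h a ((PMF.mem_support_iff _ _).2 ha)) ENNReal.toReal_nonneg

theorem integral_pmf_bind_const [MeasurableSpace β] (p : PMF α) (q : α → PMF β) {f : β → ℝ}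
    (hf : Integrable f (p.bind q).toMeasure) {c : ℝ}
    (h : ∀ a ∈ p.support, ∫ b, f b ∂(q a).toMeasure = c) :
    ∫ b, f b ∂(p.bind q).toMeasure = c := by
  refine le_antisymm (integral_pmf_bind_le p q hf fun a ha => (h a ha).le) ?_
  have := integral_pmf_bind_le p q (f := fun b => - f b) (c := -c) hf.neg
    (fun a ha => by rw [integral_neg, h a ha])
  rw [integral_neg] at this
  linarith

theorem integral_pmf_map [MeasurableSpace α] [DiscreteMeasurableSpace α] [MeasurableSpace β]
    [DiscreteMeasurableSpace β] [Countable β] (p : PMF α) (g : α → β) (f : β → ℝ) :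
    ∫ b, f b ∂(p.map g).toMeasure = ∫ a, f (g a) ∂p.toMeasure := by
  rw [← PMF.toMeasure_map g p Measurable.of_discrete,
    integral_map Measurable.of_discrete.aemeasurable
      Measurable.of_discrete.aestronglyMeasurable]

theorem integrable_pmf_of_finite [MeasurableSpace α] [DiscreteMeasurableSpace α] {p : PMF α}
    (hp : p.support.Finite) (f : α → ℝ) : Integrable f p.toMeasure := by
  have h : IntegrableOn f p.support p.toMeasure := IntegrableOn.of_finite hp
  rwa [IntegrableOn, PMF.restrict_toMeasure_support] at h

theorem ae_pmf_of_forall_support [MeasurableSpace α] [DiscreteMeasurableSpace α] {p : PMF α}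
    {P : α → Prop} (h : ∀ a ∈ p.support, P a) : ∀ᵐ a ∂p.toMeasure, P a := by
  rw [ae_iff, PMF.toMeasure_apply_eq_zero_iff _ (MeasurableSet.of_discrete)]
  exact Set.disjoint_left.2 fun a ha hn => hn (h a ha)

theorem integral_pmf_mono [MeasurableSpace α] [DiscreteMeasurableSpace α] {p : PMF α}
    {f g : α → ℝ} (hf : Integrable f p.toMeasure) (hg : Integrable g p.toMeasure)
    (h : ∀ a ∈ p.support, f a ≤ g a) : ∫ a, f a ∂p.toMeasure ≤ ∫ a, g a ∂p.toMeasure :=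
  integral_mono_ae hf hg (ae_pmf_of_forall_support h)

theorem integrable_pmf_bind [MeasurableSpace α] [DiscreteMeasurableSpace α] [Countable α]
    [MeasurableSpace β] [DiscreteMeasurableSpace β] [Countable β] (p : PMF α) (q : α → PMF β)
    {f : β → ℝ} (hf : Integrable f (p.bind q).toMeasure) :
    Integrable (fun a => ∫ b, f b ∂(q a).toMeasure) p.toMeasure := by
  refine ⟨Measurable.of_discrete.aestronglyMeasurable, ?_⟩
  have h := hf.2
  rw [HasFiniteIntegral, lintegral_pmf_bind'] at h
  exact (lintegral_mono fun a => enorm_integral_le_lintegral_enorm _).trans_lt h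

theorem integral_pmf_bind [MeasurableSpace α] [DiscreteMeasurableSpace α] [Countable α]
    [MeasurableSpace β] [DiscreteMeasurableSpace β] [Countable β] (p : PMF α) (q : α → PMF β)
    {f : β → ℝ} (hf : Integrable f (p.bind q).toMeasure) :
    ∫ b, f b ∂(p.bind q).toMeasure = ∫ a, ∫ b, f b ∂(q a).toMeasure ∂p.toMeasure := by
  rw [PMF.integral_eq_tsum _ _ (integrable_pmf_bind p q hf),
    ← (hasSum_integral_pmf_bind p q hf).tsum_eq]
  rfl

/-- Comparison theorem for a stationary law `p` of a chain with kernel `q`: if one step of the chain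
changes the mean of `V` by at most `b - f`, then `p f ≤ p b`.  No integrability of `V` is needed:
the drift condition passes to the truncations `min V n`, for which stationarity may be used. -/
theorem lintegral_le_of_drift [MeasurableSpace α] [DiscreteMeasurableSpace α]
    {p : PMF α} {q : α → PMF α} (hp : p.bind q = p) {V f b : α → ℝ≥0∞} (hV : ∀ x, V x ≠ ∞)
    (h : ∀ x, ∫⁻ y, V y ∂(q x).toMeasure + f x ≤ V x + b x) :
    ∫⁻ x, f x ∂p.toMeasure ≤ ∫⁻ x, b x ∂p.toMeasure := by
  have key : ∀ n : ℕ, ∫⁻ x, {x | V x ≤ n}.indicator f x ∂p.toMeasure ≤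
      ∫⁻ x, b x ∂p.toMeasure := by
    intro n
    have h1 : ∀ x, ∫⁻ y, min (V y) n ∂(q x).toMeasure + {x | V x ≤ n}.indicator f x ≤
        min (V x) n + b x := by
      intro x
      by_cases hx : V x ≤ n
      · rw [Set.indicator_of_mem (by exact hx), min_eq_left hx]
        exact (add_le_add_left (lintegral_mono fun y => min_le_left _ _) _).trans (h x)
      · rw [Set.indicator_of_notMem (by exact hx), min_eq_right (not_le.1 hx).le, add_zero]
        refine le_add_right ((lintegral_mono fun y => min_le_right _ _).trans ?_)
        simp
    have h2 := lintegral_mono (μ := p.toMeasure) h1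
    rw [lintegral_add_left Measurable.of_discrete, lintegral_add_left Measurable.of_discrete,
      ← lintegral_pmf_bind' p q (fun y => min (V y) n), hp] at h2
    have h3 : ∫⁻ x, min (V x) n ∂p.toMeasure ≠ ∞ := by
      refine ne_top_of_le_ne_top (ENNReal.natCast_ne_top n)
        ((lintegral_mono fun y => min_le_right _ _).trans ?_)
      simp
    exact (ENNReal.add_le_add_iff_left h3).1 h2
  have hsup : ∀ x, f x = ⨆ n : ℕ, {x | V x ≤ n}.indicator f x := by
    intro x
    obtain ⟨n, hn⟩ := ENNReal.exists_nat_gt (hV x)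
    refine le_antisymm (le_iSup_of_le n ?_) (iSup_le fun n => Set.indicator_le_self _ _ _)
    rw [Set.indicator_of_mem (by exact hn.le)]
  have hmono : Monotone fun (n : ℕ) (x : α) => {x | V x ≤ n}.indicator f x := by
    intro m n hmn x
    refine Set.indicator_le_indicator_of_subset (fun y (hy : V y ≤ m) => ?_) (fun _ => zero_le) x
    exact hy.trans (by exact_mod_cast hmn)
  calc ∫⁻ x, f x ∂p.toMeasure = ∫⁻ x, ⨆ n : ℕ, {x | V x ≤ n}.indicator f x ∂p.toMeasure :=
        lintegral_congr hsup
    _ = ⨆ n : ℕ, ∫⁻ x, {x | V x ≤ n}.indicator f x ∂p.toMeasure :=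
        lintegral_iSup (fun n => Measurable.of_discrete) hmono
    _ ≤ _ := iSup_le key

theorem integral_le_of_drift [MeasurableSpace α] [DiscreteMeasurableSpace α] [Countable α]
    {p : PMF α} {q : α → PMF α} (hp : p.bind q = p) (hq : ∀ x, (q x).support.Finite)
    {V f b : α → ℝ} (hV : ∀ x, 0 ≤ V x) (hf : ∀ x, 0 ≤ f x) (hb : ∀ x, 0 ≤ b x)
    (hbi : Integrable b p.toMeasure)
    (h : ∀ x, ∫ y, V y ∂(q x).toMeasure + f x ≤ V x + b x) :
    Integrable f p.toMeasure ∧ ∫ x, f x ∂p.toMeasure ≤ ∫ x, b x ∂p.toMeasure := by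
  have h1 := lintegral_le_of_drift hp (V := fun x => ENNReal.ofReal (V x))
    (f := fun x => ENNReal.ofReal (f x)) (b := fun x => ENNReal.ofReal (b x))
    (fun x => ENNReal.ofReal_ne_top) (fun x => by
      rw [← ofReal_integral_eq_lintegral_ofReal (integrable_pmf_of_finite (hq x) V)
        (Eventually.of_forall hV), ← ENNReal.ofReal_add (integral_nonneg hV) (hf x),
        ← ENNReal.ofReal_add (hV x) (hb x)]
      exact ENNReal.ofReal_le_ofReal (h x))
  rw [← ofReal_integral_eq_lintegral_ofReal hbi (Eventually.of_forall hb)] at h1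
  have hfi : Integrable f p.toMeasure :=
    ⟨Measurable.of_discrete.aestronglyMeasurable, by
      rw [hasFiniteIntegral_iff_ofReal (Eventually.of_forall hf)]
      exact h1.trans_lt ENNReal.ofReal_lt_top⟩
  refine ⟨hfi, ?_⟩
  rw [← ofReal_integral_eq_lintegral_ofReal hfi (Eventually.of_forall hf)] at h1
  exact (ENNReal.ofReal_le_ofReal_iff (integral_nonneg hb)).1 h1

end PMFExpectation

/-! ### Queue lengths, unused service and the gap to the cone -/

variable {N : ℕ}

/-- The total queue length; also used for the total offered service in one slot. -/
def total (Q : Fin N → ℕ) : ℝ := ∑ n, (Q n : ℝ)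

/-- The cone `K_γ` consists of the vectors of non-negative total `T` all of whose components are at
least `coneSlope N γ * T`. -/
def coneSlope (N : ℕ) (γ : ℝ) : ℝ := γ / (γ * N + 1 - γ)

/-- By how much the queue of server `n` is shorter than its lower bound in the cone `K_γ`. -/
def deficit (γ : ℝ) (Q : Fin N → ℕ) (n : Fin N) : ℝ := max (coneSlope N γ * total Q - Q n) 0

/-- The potential measuring how far the queue lengths are from the cone: it vanishes on the cone,
and is a continuously differentiable function of the queue lengths. -/
def coneGap (γ : ℝ) (Q : Fin N → ℕ) : ℝ := ∑ n, deficit γ Q n ^ 2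

/-- The unused service of server `i` in one slot. -/
def unused (Q : Fin N → ℕ) (j : Fin N) (a : ℕ) (s : Fin N → ℕ) (i : Fin N) : ℝ :=
  nextQueue Q j a s i - (Q i + (if i = j then (a : ℝ) else 0) - s i)

theorem total_nonneg (Q : Fin N → ℕ) : 0 ≤ total Q :=
  Finset.sum_nonneg fun _ _ => Nat.cast_nonneg _

theorem deficit_nonneg (γ : ℝ) (Q : Fin N → ℕ) (n : Fin N) : 0 ≤ deficit γ Q n := le_max_right _ _

theorem coneGap_nonneg (γ : ℝ) (Q : Fin N → ℕ) : 0 ≤ coneGap γ Q :=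
  Finset.sum_nonneg fun _ _ => sq_nonneg _

theorem unused_nonneg (Q : Fin N → ℕ) (j : Fin N) (a : ℕ) (s : Fin N → ℕ) (i : Fin N) :
    0 ≤ unused Q j a s i := by
  have h : (Q i : ℤ) + (if i = j then (a : ℤ) else 0) - s i ≤ nextQueue Q j a s i := by
    unfold nextQueue; split_ifs <;> omega
  have h' : ((Q i : ℝ) + (if i = j then (a : ℝ) else 0) - s i) ≤ nextQueue Q j a s i := by
    exact_mod_cast h
  exact sub_nonneg.2 h'

theorem unused_le (Q : Fin N → ℕ) (j : Fin N) (a : ℕ) (s : Fin N → ℕ) (i : Fin N) :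
    unused Q j a s i ≤ s i := by
  have h : (nextQueue Q j a s i : ℤ) ≤ (Q i : ℤ) + (if i = j then (a : ℤ) else 0) := by
    unfold nextQueue; split_ifs <;> omega
  have h' : (nextQueue Q j a s i : ℝ) ≤ (Q i : ℝ) + (if i = j then (a : ℝ) else 0) := by
    exact_mod_cast h
  unfold unused; linarith

theorem unused_eq_zero_or (Q : Fin N → ℕ) (j : Fin N) (a : ℕ) (s : Fin N → ℕ) (i : Fin N) :
    unused Q j a s i = 0 ∨ (nextQueue Q j a s i = 0 ∧ Q i ≤ s i) := by
  rcases le_total (s i) (Q i + if i = j then a else 0) with h | h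
  · left
    unfold unused nextQueue
    rw [Nat.cast_sub h]
    push_cast
    ring
  · right
    refine ⟨by unfold nextQueue; omega, by omega⟩

theorem nextQueue_cast (Q : Fin N → ℕ) (j : Fin N) (a : ℕ) (s : Fin N → ℕ) (i : Fin N) :
    (nextQueue Q j a s i : ℝ) = Q i + (if i = j then (a : ℝ) else 0) - s i + unused Q j a s i := by
  unfold unused; ring

theorem total_nextQueue (Q : Fin N → ℕ) (j : Fin N) (a : ℕ) (s : Fin N → ℕ) :
    total (nextQueue Q j a s) = total Q + (a - total s) + ∑ i, unused Q j a s i := by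
  simp only [total, nextQueue_cast, Finset.sum_add_distrib, Finset.sum_sub_distrib,
    Finset.sum_ite_eq', Finset.mem_univ, if_true]
  ring

theorem coneSlope_nonneg {γ : ℝ} (hγ0 : 0 < γ) (hγ1 : γ ≤ 1) : 0 ≤ coneSlope N γ :=
  div_nonneg hγ0.le (by have : 0 ≤ γ * N := by positivity
                        linarith)

theorem coneSlope_mul_le {γ : ℝ} (hγ0 : 0 < γ) (hγ1 : γ ≤ 1) : coneSlope N γ * N ≤ 1 := by
  have h0 : 0 ≤ γ * N := by positivity
  unfold coneSlope
  rw [div_mul_eq_mul_div]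
  exact div_le_one_of_le₀ (by linarith) (by linarith)

theorem le_coneSlope_mul {γ : ℝ} (hγ0 : 0 < γ) (hγ1 : γ ≤ 1) (hN : 0 < N) :
    γ ≤ coneSlope N γ * N := by
  have hN' : (1 : ℝ) ≤ N := by exact_mod_cast hN
  have h0 : 0 < γ * N := by positivity
  unfold coneSlope
  rw [div_mul_eq_mul_div, le_div_iff₀ (by linarith)]
  nlinarith [mul_nonneg hγ0.le (mul_nonneg (sub_nonneg.2 hγ1) (sub_nonneg.2 hN'))]

theorem deficit_eq_zero_of_mem_cone {γ : ℝ} (hγ0 : 0 < γ) (hγ1 : γ ≤ 1) {Q : Fin N → ℕ}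
    (h : (fun i => (Q i : ℝ)) ∈ cone N γ) (n : Fin N) : deficit γ Q n = 0 := by
  obtain ⟨w, hw, hQ⟩ := h
  have hQi : ∀ i, (Q i : ℝ) = γ * ∑ k, w k + (1 - γ) * w i := by
    intro i
    have := congrFun hQ i
    rw [Finset.sum_apply] at this
    have h2 : ∀ k, (w k • coneGen γ k) i = γ * w k + (if i = k then (1 - γ) * w k else 0) := by
      intro k
      simp only [Pi.smul_apply, coneGen, smul_eq_mul]
      split_ifs <;> ring
    simp only [h2, Finset.sum_add_distrib, Finset.sum_ite_eq, Finset.mem_univ, if_true,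
      ← Finset.mul_sum] at this
    exact this
  have hN : 0 < N := n.pos
  have hN' : (1 : ℝ) ≤ N := by exact_mod_cast hN
  have h0 : 0 < γ * N := by positivity
  have hT : total Q = (γ * N + 1 - γ) * ∑ k, w k := by
    simp only [total, hQi, Finset.sum_add_distrib, ← Finset.mul_sum, Finset.sum_const,
      Finset.card_univ, Fintype.card_fin, nsmul_eq_mul]
    ring
  refine max_eq_right ?_
  have : coneSlope N γ * total Q = γ * ∑ k, w k := by
    have hne : γ * N + 1 - γ ≠ 0 := by linarith
    rw [hT, coneSlope]; field_simp
  rw [this, hQi n]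
  nlinarith [mul_nonneg (sub_nonneg.2 hγ1) (hw n)]

theorem sq_posPart_add_le (x d : ℝ) :
    max (x + d) 0 ^ 2 ≤ max x 0 ^ 2 + 2 * max x 0 * d + d ^ 2 := by
  rcases max_cases (x + d) 0 with ⟨h, h'⟩ | ⟨h, h'⟩ <;> rw [h]
  · nlinarith [le_max_left x 0, le_max_right x 0]
  · nlinarith [sq_nonneg (max x 0 + d)]

/-- The first-order change of half of `coneGap` in one slot, when the unused service is ignored. -/
def linearDrift (γ : ℝ) (Q : Fin N → ℕ) (j : Fin N) (a : ℕ) (s : Fin N → ℕ) : ℝ :=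
  ∑ n, deficit γ Q n * (coneSlope N γ * (a - total s) - (if n = j then (a : ℝ) else 0) + s n)

/-- The change of `coneSlope N γ * total Q - Q n`, whose positive part is the deficit, in one
slot. -/
def surplusChange (γ : ℝ) (Q : Fin N → ℕ) (j : Fin N) (a : ℕ) (s : Fin N → ℕ) (n : Fin N) : ℝ :=
  coneSlope N γ * (total (nextQueue Q j a s) - total Q) - ((nextQueue Q j a s n : ℝ) - Q n)

theorem deficit_nextQueue (γ : ℝ) (Q : Fin N → ℕ) (j : Fin N) (a : ℕ) (s : Fin N → ℕ)
    (n : Fin N) : deficit γ (nextQueue Q j a s) n =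
      max (coneSlope N γ * total Q - Q n + surplusChange γ Q j a s n) 0 := by
  unfold deficit surplusChange
  congr 1
  ring

section Bounds

variable {K γ : ℝ} {Q : Fin N → ℕ} {j : Fin N} {a : ℕ} {s : Fin N → ℕ}

theorem total_le_of_le (hs : ∀ n, (s n : ℝ) ≤ K) : total s ≤ K * N := by
  refine (Finset.sum_le_sum fun n _ => hs n).trans ?_
  simp [mul_comm]

theorem sum_unused_nonneg : 0 ≤ ∑ i, unused Q j a s i :=
  Finset.sum_nonneg fun i _ => unused_nonneg Q j a s i

theorem sum_unused_le (hs : ∀ n, (s n : ℝ) ≤ K) : ∑ i, unused Q j a s i ≤ K * N :=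
  (Finset.sum_le_sum fun i _ => unused_le Q j a s i).trans (total_le_of_le hs)

theorem abs_total_nextQueue_sub_le (ha : (a : ℝ) ≤ K * N) (hs : ∀ n, (s n : ℝ) ≤ K) :
    |total (nextQueue Q j a s) - total Q| ≤ K * N := by
  have h1 : ∑ i, unused Q j a s i ≤ total s := Finset.sum_le_sum fun i _ => unused_le Q j a s i
  have h2 := sum_unused_nonneg (Q := Q) (j := j) (a := a) (s := s)
  have h3 := total_le_of_le hs
  have h4 : (0 : ℝ) ≤ a := Nat.cast_nonneg a
  rw [total_nextQueue, abs_le]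
  constructor <;> linarith

/-- One slot moves the deficits by `O(N)` in Euclidean norm: one server may receive `O(N)` tasks,
while all other queues change by a bounded amount. -/
theorem sum_sq_surplusChange_le (hγ0 : 0 < γ) (hγ1 : γ ≤ 1) (hK : 1 ≤ K)
    (ha : (a : ℝ) ≤ K * N) (hs : ∀ n, (s n : ℝ) ≤ K) :
    ∑ n, surplusChange γ Q j a s n ^ 2 ≤ 10 * K ^ 2 * (N : ℝ) ^ 2 := by
  have hN : (1 : ℝ) ≤ N := by exact_mod_cast j.pos
  have hκ := coneSlope_nonneg (N := N) hγ0 hγ1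
  have hκN := coneSlope_mul_le (N := N) hγ0 hγ1
  have hT : |coneSlope N γ * (total (nextQueue Q j a s) - total Q)| ≤ K := by
    rw [abs_mul, abs_of_nonneg hκ]
    calc _ ≤ coneSlope N γ * (K * N) :=
          mul_le_mul_of_nonneg_left (abs_total_nextQueue_sub_le ha hs) hκ
      _ = (coneSlope N γ * N) * K := by ring
      _ ≤ 1 * K := mul_le_mul_of_nonneg_right hκN (by linarith)
      _ = K := one_mul K
  have hb : ∀ n, surplusChange γ Q j a s n ^ 2 ≤
      8 * K ^ 2 + (if n = j then 2 * (K * N) ^ 2 else 0) := by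
    intro n
    have h1 := unused_nonneg Q j a s n
    have h2 := unused_le Q j a s n
    have h3 : (0 : ℝ) ≤ s n := Nat.cast_nonneg _
    have h4 := hs n
    have h5 : (0 : ℝ) ≤ a := Nat.cast_nonneg a
    have h6 := abs_le.1 hT
    unfold surplusChange
    rw [nextQueue_cast]
    split_ifs
    · have : |coneSlope N γ * (total (nextQueue Q j a s) - total Q) -
          (Q n + a - s n + unused Q j a s n - Q n)| ≤ 2 * K + K * N := by
        rw [abs_le]; constructor <;>
          linarith [h6.1, h6.2, mul_pos (by linarith : 0 < K) (by linarith : (0 : ℝ) < N)]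
      rw [← sq_abs]
      have := pow_le_pow_left₀ (abs_nonneg _) this 2
      nlinarith [sq_nonneg (2 * K - K * N)]
    · have : |coneSlope N γ * (total (nextQueue Q j a s) - total Q) -
          (Q n + 0 - s n + unused Q j a s n - Q n)| ≤ 2 * K := by
        rw [abs_le]; constructor <;> linarith [h6.1, h6.2]
      rw [← sq_abs]
      have := pow_le_pow_left₀ (abs_nonneg _) this 2
      nlinarith [sq_nonneg K]
  refine (Finset.sum_le_sum fun n _ => hb n).trans ?_
  simp only [Finset.sum_add_distrib, Finset.sum_const, Finset.card_univ, Fintype.card_fin,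
    nsmul_eq_mul, Finset.sum_ite_eq', Finset.mem_univ, if_true]
  nlinarith [mul_nonneg (sq_nonneg K) (mul_nonneg (by linarith : (0:ℝ) ≤ N) (sub_nonneg.2 hN))]

/-- Unused service can only increase the gap to the cone by a bounded amount: a server that wastes
service has a queue shorter than `K`, hence nearly the largest possible deficit. -/
theorem sum_deficit_mul_unused_le (hγ0 : 0 < γ) (hγ1 : γ ≤ 1)
    (hs : ∀ n, (s n : ℝ) ≤ K) :
    coneSlope N γ * (∑ i, unused Q j a s i) * (∑ n, deficit γ Q n) -
      ∑ n, deficit γ Q n * unused Q j a s n ≤ K * ∑ i, unused Q j a s i := by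
  have hκ := coneSlope_nonneg (N := N) hγ0 hγ1
  have hκN := coneSlope_mul_le (N := N) hγ0 hγ1
  have hT := total_nonneg Q
  have hG : coneSlope N γ * ∑ n, deficit γ Q n ≤ coneSlope N γ * total Q := by
    have h1 : ∑ n, deficit γ Q n ≤ N * (coneSlope N γ * total Q) := by
      refine (Finset.sum_le_sum (g := fun _ => coneSlope N γ * total Q) fun n _ => ?_).trans
        (by simp)
      exact max_le (by linarith [(Nat.cast_nonneg (Q n) : (0 : ℝ) ≤ Q n)]) (mul_nonneg hκ hT)
    calc _ ≤ coneSlope N γ * (N * (coneSlope N γ * total Q)) := mul_le_mul_of_nonneg_left h1 hκ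
      _ = (coneSlope N γ * N) * (coneSlope N γ * total Q) := by ring
      _ ≤ 1 * (coneSlope N γ * total Q) := mul_le_mul_of_nonneg_right hκN (mul_nonneg hκ hT)
      _ = _ := one_mul _
  have h : ∀ i, unused Q j a s i * (coneSlope N γ * ∑ n, deficit γ Q n - deficit γ Q i) ≤
      K * unused Q j a s i := by
    intro i
    rcases unused_eq_zero_or Q j a s i with h0 | ⟨-, h0⟩
    · simp [h0]
    · rw [mul_comm K]
      refine mul_le_mul_of_nonneg_left ?_ (unused_nonneg Q j a s i)
      have h1 : coneSlope N γ * total Q - Q i ≤ deficit γ Q i := le_max_left _ _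
      have h2 : (Q i : ℝ) ≤ s i := by exact_mod_cast h0
      linarith [hs i]
  calc _ = ∑ i, unused Q j a s i * (coneSlope N γ * ∑ n, deficit γ Q n - deficit γ Q i) := by
        simp only [mul_sub, Finset.sum_sub_distrib, ← Finset.sum_mul, mul_comm (deficit γ Q _)]
        ring
    _ ≤ ∑ i, K * unused Q j a s i := Finset.sum_le_sum fun i _ => h i
    _ = _ := by rw [Finset.mul_sum]

theorem coneGap_nextQueue_le (hγ0 : 0 < γ) (hγ1 : γ ≤ 1) (hK : 1 ≤ K)
    (ha : (a : ℝ) ≤ K * N) (hs : ∀ n, (s n : ℝ) ≤ K) :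
    coneGap γ (nextQueue Q j a s) ≤
      coneGap γ Q + 2 * linearDrift γ Q j a s + 16 * K ^ 2 * (N : ℝ) ^ 2 := by
  have hN : (1 : ℝ) ≤ N := by exact_mod_cast j.pos
  have h1 : coneGap γ (nextQueue Q j a s) ≤ coneGap γ Q +
      2 * ∑ n, deficit γ Q n * surplusChange γ Q j a s n + ∑ n, surplusChange γ Q j a s n ^ 2 := by
    unfold coneGap
    rw [Finset.mul_sum, ← Finset.sum_add_distrib, ← Finset.sum_add_distrib]
    refine Finset.sum_le_sum fun n _ => ?_
    rw [deficit_nextQueue]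
    have := sq_posPart_add_le (coneSlope N γ * total Q - Q n) (surplusChange γ Q j a s n)
    rw [← mul_assoc]
    exact this
  have h2 : ∑ n, deficit γ Q n * surplusChange γ Q j a s n = linearDrift γ Q j a s +
      (coneSlope N γ * (∑ i, unused Q j a s i) * (∑ n, deficit γ Q n) -
      ∑ n, deficit γ Q n * unused Q j a s n) := by
    unfold linearDrift
    rw [Finset.mul_sum, ← Finset.sum_sub_distrib, ← Finset.sum_add_distrib]
    refine Finset.sum_congr rfl fun n _ => ?_
    unfold surplusChange
    rw [nextQueue_cast, total_nextQueue]
    ring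
  have h3 := sum_deficit_mul_unused_le (Q := Q) (j := j) (a := a) hγ0 hγ1 hs
  have h4 := sum_sq_surplusChange_le (Q := Q) (j := j) hγ0 hγ1 hK ha hs
  have h5 : K * ∑ i, unused Q j a s i ≤ K * (K * N) :=
    mul_le_mul_of_nonneg_left (sum_unused_le hs) (by linarith)
  have h6 : K * (K * N) ≤ K ^ 2 * (N : ℝ) ^ 2 := by
    nlinarith [mul_nonneg (sq_nonneg K) (mul_nonneg (by linarith : (0:ℝ) ≤ N) (sub_nonneg.2 hN))]
  nlinarith [mul_nonneg (sq_nonneg K) (sq_nonneg (N:ℝ))]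

end Bounds

theorem sqrt_sum_sq_add_le {ι : Type*} (t : Finset ι) (x y : ι → ℝ) (b : ℝ) {D : ℝ} (hD : 0 ≤ D)
    (h : ∑ i ∈ t, (x i - y i) ^ 2 ≤ D ^ 2) :
    √(∑ i ∈ t, x i ^ 2 + b ^ 2) ≤ √(∑ i ∈ t, y i ^ 2 + b ^ 2) + D := by
  have hy : 0 ≤ ∑ i ∈ t, y i ^ 2 := Finset.sum_nonneg fun i _ => sq_nonneg _
  have hcs := Finset.sum_mul_sq_le_sq_mul_sq t y (fun i => x i - y i)
  have hcs' : ∑ i ∈ t, y i * (x i - y i) ≤ √(∑ i ∈ t, y i ^ 2 + b ^ 2) * D := by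
    refine (le_abs_self _).trans (abs_le_of_sq_le_sq ?_ (by positivity))
    rw [mul_pow, Real.sq_sqrt (by positivity)]
    calc _ ≤ _ := hcs
      _ ≤ (∑ i ∈ t, y i ^ 2) * D ^ 2 := mul_le_mul_of_nonneg_left h hy
      _ ≤ _ := by nlinarith [sq_nonneg (b * D)]
  rw [Real.sqrt_le_left (by positivity), add_sq, Real.sq_sqrt (by positivity)]
  have : ∑ i ∈ t, x i ^ 2 = ∑ i ∈ t, y i ^ 2 + 2 * ∑ i ∈ t, y i * (x i - y i) +
      ∑ i ∈ t, (x i - y i) ^ 2 := by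
    rw [Finset.mul_sum, ← Finset.sum_add_distrib, ← Finset.sum_add_distrib]
    exact Finset.sum_congr rfl fun i _ => by ring
  linarith

/-- The Euclidean norm of the vector of deficits, smoothed at the scale `b`. -/
def smoothGap (γ b : ℝ) (Q : Fin N → ℕ) : ℝ := √(coneGap γ Q + b ^ 2)

theorem abs_smoothGap_nextQueue_sub_le {K γ : ℝ} {Q : Fin N → ℕ} {j : Fin N} {a : ℕ}
    {s : Fin N → ℕ} (b : ℝ) (hγ0 : 0 < γ) (hγ1 : γ ≤ 1) (hK : 1 ≤ K)
    (ha : (a : ℝ) ≤ K * N) (hs : ∀ n, (s n : ℝ) ≤ K) :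
    |smoothGap γ b (nextQueue Q j a s) - smoothGap γ b Q| ≤ 4 * K * N := by
  have h : ∑ n, (deficit γ (nextQueue Q j a s) n - deficit γ Q n) ^ 2 ≤ (4 * K * N) ^ 2 := by
    have h1 := sum_sq_surplusChange_le (Q := Q) (j := j) hγ0 hγ1 hK ha hs
    refine (Finset.sum_le_sum fun n _ => ?_).trans (h1.trans ?_)
    · rw [deficit_nextQueue, deficit, sq_le_sq]
      refine (abs_max_sub_max_le_abs _ _ _).trans (le_of_eq ?_)
      congr 1; ring
    · nlinarith [mul_nonneg (sq_nonneg K) (sq_nonneg (N:ℝ))]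
  have h' : ∑ n, (deficit γ Q n - deficit γ (nextQueue Q j a s) n) ^ 2 ≤ (4 * K * N) ^ 2 := by
    simpa only [sub_sq_comm] using h
  have hD : 0 ≤ 4 * K * N := by positivity
  have h1 := sqrt_sum_sq_add_le Finset.univ _ _ b hD h
  have h2 := sqrt_sum_sq_add_le Finset.univ _ _ b hD h'
  unfold smoothGap coneGap
  rw [abs_le]
  constructor <;> linarith

/-- If some service is unused, then a queue is left empty. The deficit of that queue is of order
`total / N`, so that the total queue length is controlled by the gap to the cone. -/
theorem total_mul_unused_le {K γ b : ℝ} (hγ0 : 0 < γ) (hγ1 : γ ≤ 1) (hK : 1 ≤ K * γ)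
    (Q : Fin N → ℕ) (j : Fin N) (a : ℕ) (s : Fin N → ℕ) :
    (∑ i, unused Q j a s i = 0) ∨
      total (nextQueue Q j a s) ≤ K * N * smoothGap γ b (nextQueue Q j a s) := by
  by_cases hU : ∀ i, unused Q j a s i = 0
  · left; simp [hU]
  right
  push Not at hU
  obtain ⟨i, hi⟩ := hU
  have hQi := ((unused_eq_zero_or Q j a s i).resolve_left hi).1
  set Q' := nextQueue Q j a s
  have hT := total_nonneg Q'
  have h1 : coneSlope N γ * total Q' ≤ deficit γ Q' i := by
    have : coneSlope N γ * total Q' - Q' i ≤ deficit γ Q' i := le_max_left _ _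
    rwa [hQi, Nat.cast_zero, sub_zero] at this
  have h2 : deficit γ Q' i ≤ smoothGap γ b Q' := by
    refine Real.le_sqrt_of_sq_le ?_
    have := Finset.single_le_sum (f := fun n => deficit γ Q' n ^ 2) (fun n _ => sq_nonneg _)
      (Finset.mem_univ i)
    unfold coneGap
    nlinarith [sq_nonneg b]
  have h3 := le_coneSlope_mul hγ0 hγ1 i.pos
  have hK0 : 0 < K := by
    by_contra hK0
    nlinarith
  calc total Q' = 1 * total Q' := (one_mul _).symm
    _ ≤ (K * (coneSlope N γ * N)) * total Q' := by
        refine mul_le_mul_of_nonneg_right (hK.trans ?_) hT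
        exact mul_le_mul_of_nonneg_left h3 hK0.le
    _ = K * N * (coneSlope N γ * total Q') := by ring
    _ ≤ K * N * smoothGap γ b Q' := by
        refine mul_le_mul_of_nonneg_left (h1.trans h2) (by positivity)

/-! ### Mean drift towards the cone -/

namespace System

/-- The joint law of the server chosen, the arrivals and the services, when the ranking is `σ` and
the rank is drawn from `d`. -/
def routed (sys : System N) (σ : Equiv.Perm (Fin N)) (d : PMF (Fin N)) :
    PMF (Fin N × ℕ × (Fin N → ℕ)) :=
  d.bind fun n => sys.arr.bind fun a => sys.svc.map fun s => (σ n, a, s)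

/-- The joint law of the server chosen, the arrivals and the services in one slot, in state `Q`. -/
def noise (sys : System N) (Q : Fin N → ℕ) : PMF (Fin N × ℕ × (Fin N → ℕ)) :=
  (sys.pol.tie Q).bind fun σ => sys.routed σ (sys.pol.disp Q σ)

theorem step_eq_map_noise (sys : System N) (Q : Fin N → ℕ) :
    sys.step Q = (sys.noise Q).map fun ω => nextQueue Q ω.1 ω.2.1 ω.2.2 := by
  simp only [step, noise, routed, PMF.map_bind, PMF.map_comp]
  rfl

theorem integral_step (sys : System N) (Q : Fin N → ℕ) (f : (Fin N → ℕ) → ℝ) :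
    ∫ x, f x ∂(sys.step Q).toMeasure =
      ∫ ω, f (nextQueue Q ω.1 ω.2.1 ω.2.2) ∂(sys.noise Q).toMeasure := by
  rw [step_eq_map_noise, integral_pmf_map]

theorem mu_nonneg (sys : System N) (n : Fin N) : 0 ≤ sys.mu n :=
  integral_nonneg fun _ => Nat.cast_nonneg _

theorem lambdaSum_nonneg (sys : System N) : 0 ≤ sys.lambdaSum :=
  integral_nonneg fun _ => Nat.cast_nonneg _

theorem mem_support_of_mem_support_noise (sys : System N) (Q : Fin N → ℕ)
    {ω : Fin N × ℕ × (Fin N → ℕ)} (h : ω ∈ (sys.noise Q).support) :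
    ω.2.1 ∈ sys.arr.support ∧ ω.2.2 ∈ sys.svc.support := by
  simp only [noise, routed, PMF.mem_support_bind_iff, PMF.mem_support_map_iff] at h
  obtain ⟨σ, -, n, -, a, ha, s, hs, rfl⟩ := h
  exact ⟨ha, hs⟩

/-- Quantitative form of the assumptions on a system with `N` servers, in terms of a single
constant `K` which will not depend on `N`. -/
structure Regular (sys : System N) (γ c K : ℝ) : Prop where
  pos : 0 < N
  γ_pos : 0 < γ
  γ_le : γ ≤ 1
  one_le : 1 ≤ K
  one_le_mul : 1 ≤ K * γ
  arr_le : ∀ a ∈ sys.arr.support, (a : ℝ) ≤ K * N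
  svc_le : ∀ s ∈ sys.svc.support, ∀ n, (s n : ℝ) ≤ K
  lt : sys.lambdaSum < sys.muSum
  rate : 1 / K ≤ sys.lambdaSum * (c / N) - (sys.muSum - sys.lambdaSum)
  flexible : sys.InFlexibleClass γ (c / N)

/-- The heavy-traffic parameter `ε`. -/
def slack (sys : System N) : ℝ := sys.muSum - sys.lambdaSum

namespace Regular

variable {sys : System N} {γ c K : ℝ} (H : sys.Regular γ c K)

include H

theorem finite_arr : sys.arr.support.Finite := by
  refine (Set.finite_Iic ⌊K * N⌋₊).subset fun a ha => ?_
  exact Nat.le_floor (H.arr_le a ha)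

theorem finite_svc : sys.svc.support.Finite := by
  refine (Set.finite_Iic (fun _ : Fin N => ⌊K⌋₊)).subset fun s hs n => ?_
  exact Nat.le_floor (H.svc_le s hs n)

theorem finite_noise (Q : Fin N → ℕ) : (sys.noise Q).support.Finite := by
  refine (Set.finite_univ.prod (H.finite_arr.prod H.finite_svc)).subset fun ω hω => ?_
  exact ⟨trivial, sys.mem_support_of_mem_support_noise Q hω⟩

theorem finite_step (Q : Fin N → ℕ) : (sys.step Q).support.Finite := by
  rw [step_eq_map_noise, PMF.support_map]
  exact (H.finite_noise Q).image _

theorem integrable_noise (Q : Fin N → ℕ) (F : Fin N × ℕ × (Fin N → ℕ) → ℝ) :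
    Integrable F (sys.noise Q).toMeasure := integrable_pmf_of_finite (H.finite_noise Q) F

theorem integrable_arr (F : ℕ → ℝ) : Integrable F sys.arr.toMeasure :=
  integrable_pmf_of_finite H.finite_arr F

theorem integrable_svc (F : (Fin N → ℕ) → ℝ) : Integrable F sys.svc.toMeasure :=
  integrable_pmf_of_finite H.finite_svc F

theorem integral_routed (σ : Equiv.Perm (Fin N)) (d : PMF (Fin N))
    (F : Fin N × ℕ × (Fin N → ℕ) → ℝ) :
    ∫ ω, F ω ∂(sys.routed σ d).toMeasure =
      ∑ n, (d n).toReal * ∫ a, ∫ s, F (σ n, a, s) ∂sys.svc.toMeasure ∂sys.arr.toMeasure := by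
  have h1 : (sys.routed σ d).support.Finite := by
    refine (Set.finite_univ.prod (H.finite_arr.prod H.finite_svc)).subset fun ω hω => ?_
    simp only [routed, PMF.mem_support_bind_iff, PMF.mem_support_map_iff] at hω
    obtain ⟨n, -, a, ha, s, hs, rfl⟩ := hω
    exact ⟨trivial, ha, hs⟩
  have h2 : ∀ n, (sys.arr.bind fun a => sys.svc.map fun s => (σ n, a, s)).support.Finite := by
    intro n
    refine (Set.finite_univ.prod (H.finite_arr.prod H.finite_svc)).subset fun ω hω => ?_
    simp only [PMF.mem_support_bind_iff, PMF.mem_support_map_iff] at hω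
    obtain ⟨a, ha, s, hs, rfl⟩ := hω
    exact ⟨trivial, ha, hs⟩
  unfold routed at h1 ⊢
  rw [integral_pmf_bind _ _ (integrable_pmf_of_finite h1 F), PMF.integral_eq_sum]
  refine Finset.sum_congr rfl fun n _ => ?_
  rw [integral_pmf_bind _ _ (integrable_pmf_of_finite (h2 n) F), smul_eq_mul]
  congr 2
  ext a
  rw [integral_pmf_map]

/-- Arrivals and services have the same law in every state, and are independent. -/
theorem integral_noise_snd (Q : Fin N → ℕ) (F : ℕ → (Fin N → ℕ) → ℝ) :
    ∫ ω, F ω.2.1 ω.2.2 ∂(sys.noise Q).toMeasure =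
      ∫ a, ∫ s, F a s ∂sys.svc.toMeasure ∂sys.arr.toMeasure := by
  refine integral_pmf_bind_const _ _ (H.integrable_noise Q _) fun σ _ => ?_
  rw [H.integral_routed]
  dsimp only
  rw [← Finset.sum_mul]
  have : ∑ n, ((sys.pol.disp Q σ) n).toReal = 1 := by
    have h := hasSum_toReal_pmf (sys.pol.disp Q σ)
    rw [← h.tsum_eq, tsum_fintype]
  rw [this, one_mul]

theorem integral_total_svc : ∫ s, total s ∂sys.svc.toMeasure = sys.muSum := by
  unfold total muSum mu
  exact integral_finsetSum _ fun n _ => H.integrable_svc _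

theorem slack_pos : 0 < sys.slack := sub_pos.2 H.lt

theorem integral_net_input (Q : Fin N → ℕ) :
    ∫ ω, ((ω.2.1 : ℝ) - total ω.2.2) ∂(sys.noise Q).toMeasure = - sys.slack := by
  rw [H.integral_noise_snd Q fun a s => (a : ℝ) - total s]
  have : ∀ a : ℕ, ∫ s, ((a : ℝ) - total s) ∂sys.svc.toMeasure = a - sys.muSum := by
    intro a
    rw [integral_sub (H.integrable_svc _) (H.integrable_svc _), H.integral_total_svc]
    simp
  simp only [this]
  rw [integral_sub (H.integrable_arr _) (H.integrable_arr _)]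
  simp [slack, lambdaSum]

theorem integral_net_input_sq (Q : Fin N → ℕ) :
    ∫ ω, ((ω.2.1 : ℝ) - total ω.2.2) ^ 2 ∂(sys.noise Q).toMeasure =
      sys.arrVar + sys.svcVar + sys.slack ^ 2 := by
  rw [H.integral_noise_snd Q fun a s => ((a : ℝ) - total s) ^ 2]
  have hS : ∫ s, (total s) ^ 2 ∂sys.svc.toMeasure = sys.svcVar + sys.muSum ^ 2 := by
    have h2 : MemLp (fun s : Fin N → ℕ => ∑ n, (s n : ℝ)) 2 sys.svc.toMeasure := by
      rw [memLp_two_iff_integrable_sq (H.integrable_svc _).aestronglyMeasurable]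
      exact H.integrable_svc _
    have := variance_eq_sub h2
    have h3 := H.integral_total_svc
    unfold total at h3 ⊢
    unfold svcVar
    rw [this, h3]
    simp
  have hA : ∫ a, (a : ℝ) ^ 2 ∂sys.arr.toMeasure = sys.arrVar + sys.lambdaSum ^ 2 := by
    have h2 : MemLp (fun a : ℕ => (a : ℝ)) 2 sys.arr.toMeasure := by
      rw [memLp_two_iff_integrable_sq (H.integrable_arr _).aestronglyMeasurable]
      exact H.integrable_arr _
    have := variance_eq_sub h2
    unfold arrVar lambdaSum
    rw [this]
    simp
  have h : ∀ a : ℕ, ∫ s, ((a : ℝ) - total s) ^ 2 ∂sys.svc.toMeasure =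
      (a : ℝ) ^ 2 - (2 * sys.muSum) * a + (sys.svcVar + sys.muSum ^ 2) := by
    intro a
    simp only [sub_sq]
    rw [integral_add (H.integrable_svc _) (H.integrable_svc _),
      integral_sub (H.integrable_svc _) (H.integrable_svc _), hS, integral_const_mul,
      H.integral_total_svc]
    simp
    ring
  simp only [h]
  rw [integral_add (H.integrable_arr _) (H.integrable_arr _),
      integral_sub (H.integrable_arr _) (H.integrable_arr _), hA, integral_const_mul]
  have : ∫ a, (a : ℝ) ∂sys.arr.toMeasure = sys.lambdaSum := rfl
  rw [this]
  simp [slack]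
  ring

end Regular

end System

/-- A preference of the flexible form acts as a contraction on a sequence which decreases to `0`
along the ranks. -/
theorem le_sum_mul_of_preference {h Δ : Fin N → ℝ} {δ : ℝ} (first last k : Fin N)
    (hfirst : (first : ℕ) = 0) (hlast : (last : ℕ) + 1 = N) (hk : 0 < (k : ℕ))
    (hanti : ∀ m n, m ≤ n → h n ≤ h m) (h0 : h last = 0) (hsum : ∑ n, Δ n = 0)
    (hpos : ∀ n < k, 0 ≤ Δ n) (hneg : ∀ n, k ≤ n → Δ n ≤ 0)
    (hδf : δ ≤ |Δ first|) (hδl : δ ≤ |Δ last|) (m : Fin N) :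
    δ * h m ≤ ∑ n, h n * Δ n := by
  have hfm : first ≤ m := by rw [Fin.le_def]; omega
  have hfk : first < k := by rw [Fin.lt_def]; omega
  have hkl : k ≤ last := by rw [Fin.le_def]; omega
  have hne : first ≠ last := (hfk.trans_le hkl).ne
  rw [abs_of_nonneg (hpos _ hfk)] at hδf
  rw [abs_of_nonpos (hneg _ hkl)] at hδl
  have h1 : ∑ n, h n * Δ n = ∑ n, (h n - h k) * Δ n := by
    simp only [sub_mul, Finset.sum_sub_distrib, ← Finset.mul_sum, hsum, mul_zero, sub_zero]
  -- both factors change sign at the rank `k`; the first and the last term suffice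
  have h2 : ∀ n, 0 ≤ (h n - h k) * Δ n := by
    intro n
    rcases lt_or_ge n k with hn | hn
    · exact mul_nonneg (sub_nonneg.2 (hanti _ _ hn.le)) (hpos n hn)
    · exact mul_nonneg_of_nonpos_of_nonpos (sub_nonpos.2 (hanti _ _ hn)) (hneg n hn)
  have h3 : (h first - h k) * Δ first + (h last - h k) * Δ last ≤ ∑ n, (h n - h k) * Δ n := by
    rw [← Finset.sum_pair (f := fun n => (h n - h k) * Δ n) hne]
    exact Finset.sum_le_sum_of_subset_of_nonneg (Finset.subset_univ _) fun n _ _ => h2 n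
  have hk0 : 0 ≤ h k := h0 ▸ hanti _ _ hkl
  have hm0 : 0 ≤ h m := h0 ▸ hanti m last (by rw [Fin.le_def]; omega)
  have hmf := hanti _ _ hfm
  have hkf := hanti _ _ hfk.le
  rw [h1]
  refine le_trans ?_ h3
  rw [h0]
  rcases le_total 0 δ with hδ | hδ
  · nlinarith [mul_le_mul_of_nonneg_left hδf (sub_nonneg.2 hkf),
      mul_le_mul_of_nonneg_left hδl hk0, mul_le_mul_of_nonneg_left hmf hδ]
  · nlinarith [mul_nonneg (sub_nonneg.2 hkf) (hpos _ hfk),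
      mul_nonneg hk0 (neg_nonneg.2 (hneg _ hkl)), mul_nonneg hm0 (neg_nonneg.2 hδ)]

namespace System.Regular

variable {sys : System N} {γ c K : ℝ} (H : sys.Regular γ c K)

include H

theorem integral_routed_linearDrift (Q : Fin N → ℕ) (σ : Equiv.Perm (Fin N)) (d : PMF (Fin N)) :
    ∫ ω, linearDrift γ Q ω.1 ω.2.1 ω.2.2 ∂(sys.routed σ d).toMeasure =
      - coneSlope N γ * sys.slack * (∑ n, deficit γ Q n) + ∑ n, deficit γ Q n * sys.mu n -
        sys.lambdaSum * ∑ n, (d n).toReal * deficit γ Q (σ n) := by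
  rw [H.integral_routed]
  set κ := coneSlope N γ
  set G := ∑ n, deficit γ Q n with hG
  have hd : ∑ n, (d n).toReal = 1 := by
    rw [← (hasSum_toReal_pmf d).tsum_eq, tsum_fintype]
  have h0 : ∀ j a s, linearDrift γ Q j a s =
      (a : ℝ) * (κ * G - deficit γ Q j) - κ * G * total s + ∑ n, deficit γ Q n * (s n : ℝ) := by
    intro j a s
    have : ∀ n, deficit γ Q n * (κ * (a - total s) - (if n = j then (a : ℝ) else 0) + s n) =
        κ * (a - total s) * deficit γ Q n - (if n = j then deficit γ Q n * (a : ℝ) else 0) +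
          deficit γ Q n * s n := by
      intro n; split_ifs <;> ring
    unfold linearDrift
    simp only [κ] at this
    simp only [this, Finset.sum_add_distrib, Finset.sum_sub_distrib, ← Finset.mul_sum,
      Finset.sum_ite_eq', Finset.mem_univ, if_true]
    rw [← hG]; ring
  have h1 : ∀ n a, ∫ s, linearDrift γ Q (σ n) a s ∂sys.svc.toMeasure =
      (a : ℝ) * (κ * G - deficit γ Q (σ n)) +
        (∑ n, deficit γ Q n * sys.mu n - κ * G * sys.muSum) := by
    intro n a
    simp only [h0]
    rw [integral_add (H.integrable_svc _) (H.integrable_svc _),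
      integral_sub (H.integrable_svc _) (H.integrable_svc _), integral_const_mul (κ * G),
      H.integral_total_svc, integral_finsetSum _ fun n _ => H.integrable_svc _]
    simp only [integral_const_mul]
    simp only [integral_const, probReal_univ, one_smul, mu]
    ring
  have h2 : ∀ n, ∫ a, ∫ s, linearDrift γ Q (σ n) a s ∂sys.svc.toMeasure ∂sys.arr.toMeasure =
      sys.lambdaSum * (κ * G - deficit γ Q (σ n)) +
        (∑ n, deficit γ Q n * sys.mu n - κ * G * sys.muSum) := by
    intro n
    simp only [h1]
    rw [integral_add (H.integrable_arr _) (H.integrable_arr _), integral_mul_const]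
    simp [lambdaSum]
  simp only [h2]
  have h3 : ∀ n, (d n).toReal * (sys.lambdaSum * (κ * G - deficit γ Q (σ n)) +
      (∑ n, deficit γ Q n * sys.mu n - κ * G * sys.muSum)) =
      (d n).toReal * (sys.lambdaSum * (κ * G) +
      (∑ n, deficit γ Q n * sys.mu n - κ * G * sys.muSum)) -
      sys.lambdaSum * ((d n).toReal * deficit γ Q (σ n)) := by
    intro n; ring
  simp only [h3, Finset.sum_sub_distrib, ← Finset.sum_mul, ← Finset.mul_sum, hd]
  unfold slack
  ring

/-- Outside the cone the preference of the policy for short queues reduces the deficits, at a rate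
which dominates the effect `ε` of the slack capacity; inside the cone all deficits vanish. -/
theorem integral_linearDrift_le (Q : Fin N → ℕ) (m : Fin N) :
    ∫ ω, linearDrift γ Q ω.1 ω.2.1 ω.2.2 ∂(sys.noise Q).toMeasure ≤ - deficit γ Q m / K := by
  refine integral_pmf_bind_le _ _ (H.integrable_noise Q _) fun σ hσ => ?_
  rw [H.integral_routed_linearDrift]
  by_cases hQ : (fun i => (Q i : ℝ)) ∈ cone N γ
  · simp [deficit_eq_zero_of_mem_cone H.γ_pos H.γ_le hQ]
  obtain ⟨⟨k, hk, hkpos, hkneg⟩, hδ⟩ := H.flexible Q hQ σ hσ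
  have hN : 0 < N := H.pos
  have hN' : (0 : ℝ) < N := by exact_mod_cast hN
  have hsort := sys.pol.sorted Q σ hσ
  set Δ := sys.preference Q σ with hΔ
  set first : Fin N := ⟨0, hN⟩
  set last : Fin N := ⟨N - 1, by omega⟩
  have hκ := coneSlope_nonneg (N := N) H.γ_pos H.γ_le
  have hκN := coneSlope_mul_le (N := N) H.γ_pos H.γ_le
  have hmuS : 0 < sys.muSum := sys.lambdaSum_nonneg.trans_lt H.lt
  have hanti : ∀ m n, m ≤ n → deficit γ Q (σ n) ≤ deficit γ Q (σ m) := by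
    intro m n hmn
    have : ((Q (σ m) : ℕ) : ℝ) ≤ Q (σ n) := by exact_mod_cast hsort hmn
    exact max_le_max (by linarith) le_rfl
  have hmax : ∀ i, (Q i : ℝ) ≤ Q (σ last) := by
    intro i
    have : σ.symm i ≤ last := by
      have := (σ.symm i).isLt
      rw [Fin.le_def]
      show ((σ.symm i : Fin N) : ℕ) ≤ N - 1
      omega
    have := hsort this
    simp only [Function.comp, Equiv.apply_symm_apply] at this
    exact_mod_cast this
  -- the longest queue is at least the average one, so that it has no deficit
  have h0 : deficit γ Q (σ last) = 0 := by
    refine max_eq_right ?_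
    have h1 : total Q ≤ N * Q (σ last) := by
      refine (Finset.sum_le_sum fun i _ => hmax i).trans (by simp)
    have h2 : coneSlope N γ * total Q ≤ coneSlope N γ * N * Q (σ last) := by
      rw [mul_assoc]; exact mul_le_mul_of_nonneg_left h1 hκ
    have h3 : (0 : ℝ) ≤ Q (σ last) := Nat.cast_nonneg _
    nlinarith
  have hd : ∑ n, (sys.pol.disp Q σ n).toReal = 1 := by
    rw [← (hasSum_toReal_pmf (sys.pol.disp Q σ)).tsum_eq, tsum_fintype]
  have hsumμ : ∑ n, sys.mu (σ n) = sys.muSum := Equiv.sum_comp σ sys.mu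
  have hsum : ∑ n, Δ n = 0 := by
    simp only [hΔ, preference, Finset.sum_sub_distrib, ← Finset.sum_div, hd, hsumμ]
    rw [div_self hmuS.ne', sub_self]
  have hmain := fun m => le_sum_mul_of_preference (h := fun n => deficit γ Q (σ n)) first last k rfl
    (by show N - 1 + 1 = N; omega) hk hanti h0 hsum hkpos hkneg (hδ first (Or.inl rfl))
    (hδ last (Or.inr (by show N - 1 + 1 = N; omega))) m
  have hmain' : c / N * deficit γ Q m ≤ ∑ n, deficit γ Q (σ n) * Δ n := by
    have := hmain (σ.symm m)
    simpa using this
  have hfirst : ∀ i, deficit γ Q i ≤ deficit γ Q (σ first) := by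
    intro i
    have := hanti first (σ.symm i) (by rw [Fin.le_def]; exact Nat.zero_le _)
    simpa using this
  have hmain0 : c / N * deficit γ Q (σ first) ≤ ∑ n, deficit γ Q (σ n) * Δ n := by
    simpa using hmain first
  -- the part of the mean drift which is due to the slack capacity
  have e1 : ∑ n, (sys.pol.disp Q σ n).toReal * deficit γ Q (σ n) =
      ∑ n, deficit γ Q (σ n) * Δ n + (∑ n, deficit γ Q n * sys.mu n) / sys.muSum := by
    rw [← Equiv.sum_comp σ fun n => deficit γ Q n * sys.mu n, Finset.sum_div,
      ← Finset.sum_add_distrib]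
    refine Finset.sum_congr rfl fun n _ => ?_
    simp only [hΔ, preference]; ring
  have e2 : ∑ n, deficit γ Q n * sys.mu n ≤ deficit γ Q (σ first) * sys.muSum := by
    rw [muSum, Finset.mul_sum]
    exact Finset.sum_le_sum fun n _ => mul_le_mul_of_nonneg_right (hfirst n) (sys.mu_nonneg n)
  have e3 : (∑ n, deficit γ Q n * sys.mu n) / sys.muSum ≤ deficit γ Q (σ first) :=
    (div_le_iff₀ hmuS).2 e2
  set X := ∑ n, deficit γ Q n * sys.mu n with hX
  have e4 : X - sys.lambdaSum * (X / sys.muSum) = sys.slack * (X / sys.muSum) := by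
    unfold slack; field_simp
  have hslack := H.slack_pos
  have e5 : 0 ≤ coneSlope N γ * sys.slack * ∑ n, deficit γ Q n :=
    mul_nonneg (mul_nonneg hκ hslack.le) (Finset.sum_nonneg fun n _ => deficit_nonneg _ _ _)
  have hrate : 1 / K ≤ sys.lambdaSum * (c / N) - sys.slack := H.rate
  have e6 := mul_le_mul_of_nonneg_left hmain0 sys.lambdaSum_nonneg
  have e7 := mul_le_mul_of_nonneg_left e3 hslack.le
  have e8 := mul_le_mul_of_nonneg_right hrate (deficit_nonneg γ Q (σ first))
  have e9 : deficit γ Q m / K ≤ 1 / K * deficit γ Q (σ first) := by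
    rw [div_eq_mul_one_div, mul_comm]
    exact mul_le_mul_of_nonneg_left (hfirst m) (by have := H.one_le; positivity)
  rw [e1, mul_add, neg_div]
  nlinarith

end System.Regular

/-! ### Exponential moment of the gap in steady state -/

/-- The scale `N ^ (5 / 2)` on which the gap to the cone lives. -/
def gapScale (K : ℝ) (N : ℕ) : ℝ := 32 * K ^ 3 * N ^ 2 * √N

/-- The rate of the exponential moment of the gap. -/
def gapRate (K : ℝ) (N : ℕ) : ℝ := 1 / (4 * gapScale K N)

/-- The gap to the cone, smoothed at the scale `gapScale`. Since it is at least `gapScale`, the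
terms of order `N ^ 2` in the drift of its square add only `O(N ^ (-1 / 2))` to its own drift, near
the cone as well as away from it. -/
def gap (γ K : ℝ) (Q : Fin N → ℕ) : ℝ := smoothGap γ (gapScale K N) Q

theorem gap_sq (γ K : ℝ) (Q : Fin N → ℕ) : gap γ K Q ^ 2 = coneGap γ Q + gapScale K N ^ 2 :=
  Real.sq_sqrt (add_nonneg (coneGap_nonneg _ _) (sq_nonneg _))

theorem gap_nonneg (γ K : ℝ) (Q : Fin N → ℕ) : 0 ≤ gap γ K Q := Real.sqrt_nonneg _

theorem gapScale_le_gap (γ K : ℝ) (Q : Fin N → ℕ) : gapScale K N ≤ gap γ K Q := by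
  refine Real.le_sqrt_of_sq_le ?_
  linarith [coneGap_nonneg γ Q]

namespace System.Regular

variable {sys : System N} {γ c K : ℝ} (H : sys.Regular γ c K)

include H

theorem gapScale_pos : 0 < gapScale K N := by
  have hN : (0 : ℝ) < N := by exact_mod_cast H.pos
  have := H.one_le
  unfold gapScale; positivity

theorem gapRate_pos : 0 < gapRate K N := by
  have := H.gapScale_pos
  unfold gapRate; positivity

theorem exists_coneGap_le (Q : Fin N → ℕ) : ∃ m, coneGap γ Q ≤ N * deficit γ Q m ^ 2 := by
  have : Nonempty (Fin N) := ⟨⟨0, H.pos⟩⟩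
  obtain ⟨m, hm⟩ := Finite.exists_max (deficit γ Q)
  refine ⟨m, (Finset.sum_le_sum (g := fun _ => deficit γ Q m ^ 2) fun n _ => ?_).trans (by simp)⟩
  exact pow_le_pow_left₀ (deficit_nonneg _ _ _) (hm n) 2

/-- Geometric drift of the exponential of the gap. -/
theorem integral_exp_gap_step_le (Q : Fin N → ℕ) :
    ∫ x, Real.exp (gapRate K N * gap γ K x) ∂(sys.step Q).toMeasure +
        gapRate K N / (8 * K * √N) * Real.exp (gapRate K N * gap γ K Q) ≤
      Real.exp (gapRate K N * gap γ K Q) +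
        gapRate K N / (8 * K * √N) * (4 * Real.exp (1 / 2)) := by
  have hN : (1 : ℝ) ≤ N := by exact_mod_cast H.pos
  have hK := H.one_le
  have hK0 : 0 < K := by linarith
  set w := √(N : ℝ) with hw
  have hw2 : w ^ 2 = N := Real.sq_sqrt (by linarith)
  have hw1 : 1 ≤ w := Real.one_le_sqrt.2 hN
  set B := gapScale K N with hB
  have hB' : B = 32 * K ^ 3 * N ^ 2 * w := rfl
  have hB0 : 0 < B := H.gapScale_pos
  set θ := gapRate K N with hθ
  have hθB : θ * B = 1 / 4 := by
    rw [hθ, gapRate, ← hB]; field_simp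
  have hθ0 : 0 < θ := H.gapRate_pos
  set ρ := θ / (8 * K * w) with hρ
  have hρ0 : 0 < ρ := by positivity
  have hρθ : θ = ρ * (8 * K * w) := by rw [hρ]; field_simp
  set L := gap γ K Q with hL
  have hLB : B ≤ L := gapScale_le_gap γ K Q
  have hL0 : 0 < L := hB0.trans_le hLB
  have hD : θ * (4 * K * N) ≤ 1 := by
    have : 4 * K * N ≤ 4 * B := by
      rw [hB']
      have h1 : K * N ≤ K ^ 3 * N ^ 2 * w := by
        have h2 : 1 ≤ K ^ 2 * N * w := by
          have : 1 ≤ K ^ 2 := one_le_pow₀ hK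
          nlinarith [mul_le_mul this hN (by norm_num) (by positivity),
            mul_nonneg (by positivity : 0 ≤ K ^ 2 * N) (sub_nonneg.2 hw1)]
        calc K * N = K * N * 1 := by ring
          _ ≤ K * N * (K ^ 2 * N * w) := by gcongr
          _ = _ := by ring
      nlinarith [mul_pos hK0 (by linarith : (0:ℝ) < N)]
    nlinarith
  have hD2 : θ ^ 2 * (4 * K * N) ^ 2 = ρ := by
    have : θ * (16 * K ^ 2 * N ^ 2 * (8 * K * w)) = 1 := by
      have : 16 * K ^ 2 * N ^ 2 * (8 * K * w) = 4 * B := by rw [hB']; ring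
      rw [this]; linarith
    calc θ ^ 2 * (4 * K * N) ^ 2 = θ * (θ * (16 * K ^ 2 * N ^ 2)) := by ring
      _ = θ * (ρ * (8 * K * w) * (16 * K ^ 2 * N ^ 2)) := by rw [← hρθ]
      _ = ρ * (θ * (16 * K ^ 2 * N ^ 2 * (8 * K * w))) := by ring
      _ = ρ := by rw [this, mul_one]
  have hE : 8 * K ^ 2 * N ^ 2 * (4 * K * w) = B := by rw [hB']; ring
  set V := Real.exp (θ * L) with hV
  have hV0 : 0 < V := Real.exp_pos _
  -- the one-step change of the exponential along each realisation of the noise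
  have hpt : ∀ ω ∈ (sys.noise Q).support,
      Real.exp (θ * gap γ K (nextQueue Q ω.1 ω.2.1 ω.2.2)) ≤
        V * (1 + ρ) + V * θ / L * (8 * K ^ 2 * N ^ 2) +
          V * θ / L * linearDrift γ Q ω.1 ω.2.1 ω.2.2 := by
    intro ω hω
    obtain ⟨ha, hs⟩ := sys.mem_support_of_mem_support_noise Q hω
    have ha := H.arr_le _ ha
    have hs := H.svc_le _ hs
    have hj := abs_smoothGap_nextQueue_sub_le (Q := Q) (j := ω.1) B H.γ_pos H.γ_le hK ha hs
    have hΦ := coneGap_nextQueue_le (Q := Q) (j := ω.1) H.γ_pos H.γ_le hK ha hs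
    set L' := gap γ K (nextQueue Q ω.1 ω.2.1 ω.2.2) with hL'
    set ℓ := linearDrift γ Q ω.1 ω.2.1 ω.2.2
    change |L' - L| ≤ 4 * K * N at hj
    have hx : L' - L ≤ (ℓ + 8 * K ^ 2 * N ^ 2) / L := by
      rw [le_div_iff₀ hL0]
      have h1 := gap_sq γ K (nextQueue Q ω.1 ω.2.1 ω.2.2)
      have h2 := gap_sq γ K Q
      rw [← hL'] at h1
      rw [← hL] at h2
      nlinarith [sq_nonneg (L' - L)]
    have hx1 : |θ * (L' - L)| ≤ 1 := by
      rw [abs_mul, abs_of_pos hθ0]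
      exact (mul_le_mul_of_nonneg_left hj hθ0.le).trans hD
    have hx2 := (abs_le.1 (Real.abs_exp_sub_one_sub_id_le hx1)).2
    have hx3 : (θ * (L' - L)) ^ 2 ≤ ρ := by
      rw [← hD2, mul_pow]
      refine mul_le_mul_of_nonneg_left ?_ (sq_nonneg θ)
      rw [← sq_abs]
      exact pow_le_pow_left₀ (abs_nonneg _) hj 2
    have hx4 : Real.exp (θ * (L' - L)) ≤ 1 + ρ + θ * ((ℓ + 8 * K ^ 2 * N ^ 2) / L) := by
      have := mul_le_mul_of_nonneg_left hx hθ0.le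
      linarith
    calc Real.exp (θ * L') = V * Real.exp (θ * (L' - L)) := by
          rw [hV, ← Real.exp_add]; congr 1; ring
      _ ≤ V * (1 + ρ + θ * ((ℓ + 8 * K ^ 2 * N ^ 2) / L)) := mul_le_mul_of_nonneg_left hx4 hV0.le
      _ = _ := by ring
  have hint : ∫ x, Real.exp (θ * gap γ K x) ∂(sys.step Q).toMeasure ≤
      V * (1 + ρ) + V * θ / L * (8 * K ^ 2 * N ^ 2) +
        V * θ / L * ∫ ω, linearDrift γ Q ω.1 ω.2.1 ω.2.2 ∂(sys.noise Q).toMeasure := by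
    rw [sys.integral_step]
    refine (integral_pmf_mono (H.integrable_noise Q _) (H.integrable_noise Q _) hpt).trans ?_
    rw [integral_add (H.integrable_noise Q _) (H.integrable_noise Q _), integral_const_mul]
    simp
  set I := ∫ ω, linearDrift γ Q ω.1 ω.2.1 ω.2.2 ∂(sys.noise Q).toMeasure with hI
  have hquad : V * θ / L * (8 * K ^ 2 * N ^ 2) ≤ 2 * ρ * V := by
    have h1 : 8 * K ^ 2 * N ^ 2 ≤ L / (4 * K * w) := by
      rw [le_div_iff₀ (by positivity), hE]; exact hLB
    calc V * θ / L * (8 * K ^ 2 * N ^ 2) ≤ V * θ / L * (L / (4 * K * w)) := by gcongr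
      _ = 2 * ρ * V := by rw [hρθ]; field_simp; norm_num
  -- Near the cone the gap is at most `2 B`, and the exponential is bounded; away from the cone its
  -- linear drift `-4 ρ V` dominates the quadratic terms, which sum to `3 ρ V`.
  rcases lt_or_ge (coneGap γ Q) (B ^ 2) with hc | hc
  · have hI0 : I ≤ 0 := by
      refine (H.integral_linearDrift_le Q ⟨0, H.pos⟩).trans ?_
      rw [neg_div]
      exact neg_nonpos.2 (div_nonneg (deficit_nonneg _ _ _) hK0.le)
    have hL2 : L ≤ 2 * B := by
      refine (le_abs_self _).trans (abs_le_of_sq_le_sq ?_ (by linarith))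
      rw [gap_sq]; nlinarith
    have hVe : V ≤ Real.exp (1 / 2) := Real.exp_le_exp.2
      (by linarith [mul_le_mul_of_nonneg_left hL2 hθ0.le])
    have := mul_nonpos_of_nonneg_of_nonpos (by positivity : 0 ≤ V * θ / L) hI0
    linarith [mul_le_mul_of_nonneg_left hVe hρ0.le]
  · obtain ⟨m, hm⟩ := H.exists_coneGap_le (γ := γ) Q
    have hIm := H.integral_linearDrift_le Q m
    have hLm : L ≤ 2 * w * deficit γ Q m := by
      refine (le_abs_self _).trans (abs_le_of_sq_le_sq ?_
        (mul_nonneg (by linarith) (deficit_nonneg _ _ _)))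
      rw [gap_sq, mul_pow, mul_pow, hw2]; nlinarith
    have h1 : V * θ / L * I ≤ - (4 * ρ * V) := by
      have h2 : I ≤ - (L / (2 * K * w)) := by
        refine hIm.trans ?_
        rw [neg_div, neg_le_neg_iff, div_le_div_iff₀ (by positivity) hK0]
        have := mul_le_mul_of_nonneg_right hLm hK0.le
        linarith
      calc V * θ / L * I ≤ V * θ / L * (- (L / (2 * K * w))) := by gcongr
        _ = - (4 * ρ * V) := by rw [hρθ]; field_simp; norm_num
    have := mul_pos hρ0 (Real.exp_pos (1/2))
    linarith

variable {π : PMF (Fin N → ℕ)} (hπ : sys.IsStationary π)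

include hπ

theorem integral_exp_gap_le :
    Integrable (fun Q => Real.exp (gapRate K N * gap γ K Q)) π.toMeasure ∧
      ∫ Q, Real.exp (gapRate K N * gap γ K Q) ∂π.toMeasure ≤ 8 := by
  have hN : (1 : ℝ) ≤ N := by exact_mod_cast H.pos
  have hK0 : 0 < K := by linarith [H.one_le]
  have hρ0 : 0 < gapRate K N / (8 * K * √N) := by
    have := H.gapRate_pos
    positivity
  obtain ⟨h1, h2⟩ := integral_le_of_drift (p := π) (q := sys.step) hπ H.finite_step
    (V := fun Q => Real.exp (gapRate K N * gap γ K Q))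
    (f := fun Q => gapRate K N / (8 * K * √N) * Real.exp (gapRate K N * gap γ K Q))
    (b := fun _ => gapRate K N / (8 * K * √N) * (4 * Real.exp (1 / 2)))
    (fun x => (Real.exp_pos _).le) (fun x => by positivity) (fun x => by positivity)
    (integrable_const _) H.integral_exp_gap_step_le
  have h3 := h1.const_mul (gapRate K N / (8 * K * √N))⁻¹
  simp only [inv_mul_cancel_left₀ hρ0.ne'] at h3
  refine ⟨h3, ?_⟩
  rw [integral_const_mul, integral_const, probReal_univ, one_smul] at h2
  refine (le_of_mul_le_mul_left h2 hρ0).trans ?_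
  have h4 : Real.exp (1 / 2) ≤ 2 := by
    have h5 : Real.exp (1 / 2) ^ 2 = Real.exp 1 := by rw [← Real.exp_nat_mul]; norm_num
    have := Real.exp_one_lt_d9
    refine (le_abs_self _).trans (abs_le_of_sq_le_sq ?_ (by norm_num))
    rw [h5]; linarith
  linarith

end System.Regular

/-! ### Moments of the total queue length and mean unused service -/

theorem rpow_le_mul_exp {θ r x : ℝ} (hθ : 0 < θ) (hr : 0 < r) (hx : 0 ≤ x) :
    x ^ r ≤ (r / θ) ^ r * Real.exp (θ * x) := by
  have h1 : θ * x / r ≤ Real.exp (θ * x / r) := by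
    linarith [Real.add_one_le_exp (θ * x / r)]
  have h2 : x = (r / θ) * (θ * x / r) := by field_simp
  have h3 : Real.exp (θ * x) = Real.exp (θ * x / r) ^ r := by
    rw [← Real.exp_mul]; congr 1; field_simp
  rw [h3, ← Real.mul_rpow (by positivity) (Real.exp_pos _).le]
  refine Real.rpow_le_rpow hx ?_ hr.le
  calc x = (r / θ) * (θ * x / r) := h2
    _ ≤ _ := by gcongr

/-- Splitting according to whether `x ≤ τ`: a substitute for Hölder's inequality in which the
threshold `τ` is chosen later. -/
theorem mul_le_add_rpow {τ r x u M : ℝ} (hτ : 0 < τ) (hr : 1 ≤ r) (hx : 0 ≤ x) (hu : 0 ≤ u)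
    (huM : u ≤ M) : x * u ≤ τ * u + M * τ ^ (1 - r) * x ^ r := by
  have hM : 0 ≤ M := hu.trans huM
  have h0 : 0 ≤ M * τ ^ (1 - r) * x ^ r := by positivity
  rcases le_total x τ with h | h
  · have := mul_le_mul_of_nonneg_right h hu
    linarith
  · have hx0 : 0 < x := hτ.trans_le h
    have h1 : x ≤ τ ^ (1 - r) * x ^ r := by
      calc x = x ^ (1 - r) * x ^ r := by
            rw [← Real.rpow_add hx0]; simp
        _ ≤ τ ^ (1 - r) * x ^ r := by
            gcongr ?_ * _
            exact Real.rpow_le_rpow_of_nonpos hτ h (by linarith)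
    calc x * u ≤ (τ ^ (1 - r) * x ^ r) * M := mul_le_mul h1 huM hu (by positivity)
      _ = M * τ ^ (1 - r) * x ^ r := by ring
      _ ≤ _ := by linarith [mul_nonneg hτ.le hu]

/-- Mean unused service in one slot, from the state `Q`. -/
def System.meanUnused (sys : System N) (Q : Fin N → ℕ) : ℝ :=
  ∫ ω, (∑ i, unused Q ω.1 ω.2.1 ω.2.2 i) ∂(sys.noise Q).toMeasure

theorem System.meanUnused_nonneg (sys : System N) (Q : Fin N → ℕ) : 0 ≤ sys.meanUnused Q :=
  integral_nonneg fun _ => sum_unused_nonneg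

theorem System.IsStationary.integrable_step {sys : System N} {π : PMF (Fin N → ℕ)}
    (hπ : sys.IsStationary π) {f : (Fin N → ℕ) → ℝ} (hf : Integrable f π.toMeasure) :
    Integrable (fun Q => ∫ x, f x ∂(sys.step Q).toMeasure) π.toMeasure := by
  have h := integrable_pmf_bind π sys.step (f := f)
  rw [show π.bind sys.step = π from hπ] at h
  exact h hf

theorem System.IsStationary.integral_step {sys : System N} {π : PMF (Fin N → ℕ)}
    (hπ : sys.IsStationary π) {f : (Fin N → ℕ) → ℝ} (hf : Integrable f π.toMeasure) :
    ∫ Q, ∫ x, f x ∂(sys.step Q).toMeasure ∂π.toMeasure = ∫ x, f x ∂π.toMeasure := by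
  have h := integral_pmf_bind π sys.step (f := f)
  rw [show π.bind sys.step = π from hπ] at h
  exact (h hf).symm

namespace System.Regular

variable {sys : System N} {γ c K : ℝ} (H : sys.Regular γ c K)

include H

theorem scale_pos : 0 < K * N := by
  have hN : (0 : ℝ) < N := by exact_mod_cast H.pos
  have := H.one_le
  positivity

theorem meanUnused_le (Q : Fin N → ℕ) : sys.meanUnused Q ≤ K * N := by
  refine (integral_pmf_mono (H.integrable_noise Q _) (H.integrable_noise Q fun _ => K * N)
    fun ω hω => ?_).trans (by simp)
  exact sum_unused_le (H.svc_le _ (sys.mem_support_of_mem_support_noise Q hω).2)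

theorem integrable_meanUnused (π : PMF (Fin N → ℕ)) :
    Integrable sys.meanUnused π.toMeasure := by
  refine Integrable.of_bound Measurable.of_discrete.aestronglyMeasurable (K * N)
    (Eventually.of_forall fun Q => ?_)
  rw [Real.norm_of_nonneg (sys.meanUnused_nonneg Q)]
  exact H.meanUnused_le Q

theorem integral_total_step (Q : Fin N → ℕ) :
    ∫ x, total x ∂(sys.step Q).toMeasure = total Q - sys.slack + sys.meanUnused Q := by
  rw [sys.integral_step]
  simp only [total_nextQueue]
  rw [integral_add (H.integrable_noise Q _) (H.integrable_noise Q _),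
    integral_add (H.integrable_noise Q _) (H.integrable_noise Q _), H.integral_net_input]
  simp only [integral_const, probReal_univ, one_smul, meanUnused]
  ring

/-- Drift of the cube of the total queue length. -/
theorem integral_total_cube_step_le (Q : Fin N → ℕ) :
    ∫ x, total x ^ 3 ∂(sys.step Q).toMeasure + 2 * sys.slack * total Q ^ 2 ≤ total Q ^ 3 +
      ((K * N) ^ 3 + 3 * (K * N) ^ 4 / sys.slack +
        3 * (K * N) ^ 3 * (2 * gap γ K Q ^ (2 : ℝ) + 50 * (K * N) ^ 2)) := by
  set M := K * N with hM
  have hM0 : 0 < M := H.scale_pos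
  set T := total Q with hT
  have hT0 : 0 ≤ T := total_nonneg Q
  set L := gap γ K Q with hL
  have hL0 : 0 ≤ L := gap_nonneg _ _ _
  set ε := sys.slack with hε
  have hε0 : 0 < ε := H.slack_pos
  have hpt : ∀ ω ∈ (sys.noise Q).support, total (nextQueue Q ω.1 ω.2.1 ω.2.2) ^ 3 ≤
      (T ^ 3 + 3 * T * M ^ 2 + M ^ 3 + 3 * M ^ 3 * (L + 5 * M) ^ 2) +
        3 * T ^ 2 * ((ω.2.1 : ℝ) - total ω.2.2) := by
    intro ω hω
    obtain ⟨ha, hs⟩ := sys.mem_support_of_mem_support_noise Q hω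
    have ha := H.arr_le _ ha
    have hs := H.svc_le _ hs
    have hj := abs_smoothGap_nextQueue_sub_le (Q := Q) (j := ω.1) (gapScale K N) H.γ_pos H.γ_le
      H.one_le ha hs
    have hx := abs_total_nextQueue_sub_le (Q := Q) (j := ω.1) ha hs
    have hor := total_mul_unused_le (b := gapScale K N) H.γ_pos H.γ_le H.one_le_mul Q ω.1 ω.2.1
      ω.2.2
    have hU0 := sum_unused_nonneg (Q := Q) (j := ω.1) (a := ω.2.1) (s := ω.2.2)
    have hUM := sum_unused_le (Q := Q) (j := ω.1) (a := ω.2.1) hs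
    have hTn := total_nextQueue Q ω.1 ω.2.1 ω.2.2
    set T' := total (nextQueue Q ω.1 ω.2.1 ω.2.2)
    set L' := smoothGap γ (gapScale K N) (nextQueue Q ω.1 ω.2.1 ω.2.2) with hL'
    set U := ∑ i, unused Q ω.1 ω.2.1 ω.2.2 i
    change |L' - L| ≤ _ at hj
    rw [← hT] at hx hTn
    rw [← hM] at hx hUM hor
    set d := (ω.2.1 : ℝ) - total ω.2.2
    have hj' := abs_le.1 hj
    have hx' := abs_le.1 hx
    have hTU : T ^ 2 * U ≤ M ^ 3 * (L + 5 * M) ^ 2 := by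
      rcases hor with h | h
      · rw [h, mul_zero]; positivity
      · have h1 : T ≤ M * (L + 5 * M) := by
          have h2 : L' ≤ L + 4 * M := by linarith [hj'.2, hM]
          have h3 := mul_le_mul_of_nonneg_left h2 hM0.le
          have h4 : M ≤ M * M := by
            have hN : (1 : ℝ) ≤ N := by exact_mod_cast H.pos
            have : 1 ≤ M := one_le_mul_of_one_le_of_one_le H.one_le hN
            nlinarith
          nlinarith [hx'.1]
        calc T ^ 2 * U ≤ (M * (L + 5 * M)) ^ 2 * M := by gcongr
          _ = _ := by ring
    have hT' : T' = T + (T' - T) := by ring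
    set x := T' - T with hxdef
    have hxd : x = d + U := by linarith
    have hx2 : x ^ 2 ≤ M ^ 2 := by rw [← sq_abs]; exact pow_le_pow_left₀ (abs_nonneg _) hx 2
    have hx3 : x ^ 3 ≤ M ^ 3 := by
      refine (le_abs_self _).trans ?_
      rw [abs_pow]; exact pow_le_pow_left₀ (abs_nonneg _) hx 3
    have hTx := mul_le_mul_of_nonneg_left hx2 hT0
    calc T' ^ 3 = T ^ 3 + 3 * (T ^ 2 * x) + 3 * (T * x ^ 2) + x ^ 3 := by rw [hT']; ring
      _ = T ^ 3 + 3 * T ^ 2 * d + 3 * (T ^ 2 * U) + 3 * (T * x ^ 2) + x ^ 3 := by rw [hxd]; ring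
      _ ≤ _ := by linarith
  rw [sys.integral_step]
  have h1 := integral_pmf_mono (H.integrable_noise Q _) (H.integrable_noise Q _) hpt
  rw [integral_add (H.integrable_noise Q _) (H.integrable_noise Q _), integral_const_mul,
    H.integral_net_input, ← hε] at h1
  simp only [integral_const, probReal_univ, one_smul] at h1
  have h2 : 3 * T * M ^ 2 ≤ ε * T ^ 2 + 3 * M ^ 4 / ε := by
    have : 0 ≤ (ε * T - 3 / 2 * M ^ 2) ^ 2 / ε := by positivity
    have h3 : (ε * T - 3 / 2 * M ^ 2) ^ 2 / ε =
        ε * T ^ 2 - 3 * T * M ^ 2 + 9 / 4 * (M ^ 4 / ε) := by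
      field_simp; ring
    have h4 : 0 ≤ M ^ 4 / ε := by positivity
    have h5 : 3 * M ^ 4 / ε = 3 * (M ^ 4 / ε) := by ring
    rw [h5]; linarith
  have h3 : (L + 5 * M) ^ 2 ≤ 2 * L ^ (2 : ℝ) + 50 * M ^ 2 := by
    rw [Real.rpow_two]; nlinarith [sq_nonneg (L - 5 * M)]
  have h4 := mul_le_mul_of_nonneg_left h3 (by positivity : 0 ≤ 3 * M ^ 3)
  linarith

variable {π : PMF (Fin N → ℕ)} (hπ : sys.IsStationary π)

include hπ

theorem integral_gap_rpow_le {r : ℝ} (hr : 0 < r) :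
    Integrable (fun Q => gap γ K Q ^ r) π.toMeasure ∧
      ∫ Q, gap γ K Q ^ r ∂π.toMeasure ≤ 8 * (r / gapRate K N) ^ r := by
  obtain ⟨h1, h2⟩ := H.integral_exp_gap_le hπ
  have hθ := H.gapRate_pos
  have hle : ∀ Q : Fin N → ℕ, gap γ K Q ^ r ≤
      (r / gapRate K N) ^ r * Real.exp (gapRate K N * gap γ K Q) :=
    fun Q => rpow_le_mul_exp hθ hr (gap_nonneg γ K Q)
  have h3 : Integrable (fun Q => gap γ K Q ^ r) π.toMeasure := by
    refine (h1.const_mul ((r / gapRate K N) ^ r)).mono'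
      Measurable.of_discrete.aestronglyMeasurable (Eventually.of_forall fun Q => ?_)
    rw [Real.norm_of_nonneg (Real.rpow_nonneg (gap_nonneg γ K Q) r)]
    exact hle Q
  refine ⟨h3, (integral_mono h3 (h1.const_mul _) hle).trans ?_⟩
  rw [integral_const_mul, mul_comm 8]
  exact mul_le_mul_of_nonneg_left h2 (by positivity)

/-- Drift argument with the cube of the total queue length. Inside the cone the policy is arbitrary,
so only the total, which does not depend on the routing, can serve as Lyapunov function. -/
theorem integrable_total_sq : Integrable (fun Q => total Q ^ 2) π.toMeasure := by
  have hε := H.slack_pos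
  have hM := H.scale_pos
  have hL := (H.integral_gap_rpow_le hπ (r := 2) (by norm_num)).1
  obtain ⟨h1, -⟩ := integral_le_of_drift (p := π) (q := sys.step) hπ H.finite_step
    (V := fun Q => total Q ^ 3) (f := fun Q => 2 * sys.slack * total Q ^ 2)
    (fun x => pow_nonneg (total_nonneg x) 3) (fun x => by positivity)
    (fun x => by have := gap_nonneg γ K x; positivity)
    (by fun_prop) H.integral_total_cube_step_le
  have h3 := h1.const_mul (2 * sys.slack)⁻¹
  have hne : 2 * sys.slack ≠ 0 := by positivity
  simpa only [inv_mul_cancel_left₀ hne] using h3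

theorem integrable_total : Integrable (fun Q => total Q) π.toMeasure := by
  have h := H.integrable_total_sq hπ
  refine ((integrable_const (1 : ℝ)).add h).mono' Measurable.of_discrete.aestronglyMeasurable
    (Eventually.of_forall fun Q => ?_)
  rw [Real.norm_of_nonneg (total_nonneg Q), Pi.add_apply]
  nlinarith [sq_nonneg (total Q - 1 / 2)]

/-- In steady state the mean unused service equals the slack capacity. -/
theorem integral_meanUnused : ∫ Q, sys.meanUnused Q ∂π.toMeasure = sys.slack := by
  have hi := H.integrable_total hπ
  have h := hπ.integral_step hi
  simp only [H.integral_total_step] at h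
  have hi' : Integrable (fun Q => total Q - sys.slack) π.toMeasure := hi.sub (integrable_const _)
  rw [integral_add hi' (H.integrable_meanUnused π),
    integral_sub hi (integrable_const _)] at h
  simp only [integral_const, probReal_univ, one_smul] at h
  linarith

end System.Regular

/-! ### The Stein equation of the exponential law -/

section Exponential

variable {ρ : ℝ}

theorem expMeasure_eq (ρ : ℝ) : expMeasure ρ =
    (volume.restrict (Set.Ioi 0)).withDensity fun x =>
      ENNReal.ofReal (ρ * Real.exp (-(ρ * x))) := by
  have h0 : expMeasure ρ = volume.withDensity (exponentialPDF ρ) := rfl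
  rw [h0, restrict_Ioi_eq_restrict_Ici, ← withDensity_indicator measurableSet_Ici]
  congr 1
  ext x
  rw [exponentialPDF_eq]
  by_cases hx : 0 ≤ x
  · rw [Set.indicator_of_mem (by exact hx), if_pos hx]
  · rw [Set.indicator_of_notMem (by exact hx), if_neg hx, ENNReal.ofReal_zero]

theorem integrable_expMeasure_iff (hρ : 0 < ρ) (F : ℝ → ℝ) :
    Integrable F (expMeasure ρ) ↔
      IntegrableOn (fun x => ρ * Real.exp (-(ρ * x)) * F x) (Set.Ioi 0) := by
  rw [expMeasure_eq, integrable_withDensity_iff (by fun_prop) (by simp)]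
  refine integrable_congr (Eventually.of_forall fun x => ?_)
  simp only
  rw [ENNReal.toReal_ofReal (by positivity), mul_comm]

theorem integral_expMeasure (hρ : 0 < ρ) (F : ℝ → ℝ) :
    ∫ x, F x ∂(expMeasure ρ) = ∫ x in Set.Ioi 0, ρ * Real.exp (-(ρ * x)) * F x := by
  rw [expMeasure_eq, integral_withDensity_eq_integral_toReal_smul (by fun_prop) (by simp)]
  refine integral_congr_ae (Eventually.of_forall fun x => ?_)
  simp only
  rw [ENNReal.toReal_ofReal (by positivity), smul_eq_mul]

theorem integrable_id_expMeasure (hρ : 0 < ρ) : Integrable (fun x : ℝ => x) (expMeasure ρ) := by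
  rw [integrable_expMeasure_iff hρ]
  have h := integrableOn_rpow_mul_exp_neg_mul_rpow (p := 1) (s := 1) (b := ρ) (by norm_num)
    (by norm_num) hρ
  refine (h.const_mul ρ).congr (Eventually.of_forall fun x => ?_)
  simp only [Real.rpow_one, neg_mul]
  ring

theorem integrable_lipschitz_expMeasure (hρ : 0 < ρ) {h : ℝ → ℝ} (hh : LipschitzWith 1 h)
    (x : ℝ) :
    Integrable (fun y => h (x + y)) (expMeasure ρ) := by
  have := isProbabilityMeasure_expMeasure hρ
  have h1 : Integrable (fun y => |h x| + |y|) (expMeasure ρ) :=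
    (integrable_const _).add (integrable_id_expMeasure hρ).abs
  refine h1.mono' (hh.continuous.comp (by fun_prop)).aestronglyMeasurable
    (Eventually.of_forall fun y => ?_)
  have h2 := hh.dist_le_mul (x + y) x
  rw [Real.dist_eq, Real.dist_eq] at h2
  simp only [NNReal.coe_one, one_mul, add_sub_cancel_left] at h2
  rw [Real.norm_eq_abs]
  have := abs_sub_abs_le_abs_sub (h (x + y)) (h x)
  linarith

/-- The substitution `u = x + y` makes the dependence on `x` differentiable even if `h` is not. -/
theorem integral_add_expMeasure (hρ : 0 < ρ) {h : ℝ → ℝ} (hh : LipschitzWith 1 h) (x : ℝ) :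
    ∫ y, h (x + y) ∂(expMeasure ρ) = Real.exp (ρ * x) *
      (∫ y, h y ∂(expMeasure ρ) - ∫ u in (0 : ℝ)..x, ρ * Real.exp (-(ρ * u)) * h u) := by
  set φ : ℝ → ℝ := fun u => ρ * Real.exp (-(ρ * u)) * h u with hφ
  have hsub : ∀ y, ρ * Real.exp (-(ρ * y)) * h (x + y) = Real.exp (ρ * x) * φ (x + y) := by
    intro y
    simp only [hφ]
    have : Real.exp (-(ρ * y)) = Real.exp (ρ * x) * Real.exp (-(ρ * (x + y))) := by
      rw [← Real.exp_add]; congr 1; ring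
    rw [this]; ring
  have hind : ∀ y, (Set.Ioi 0).indicator (fun y => φ (x + y)) y =
      (Set.Ioi x).indicator φ (x + y) := by
    intro y
    by_cases hy : 0 < y
    · rw [Set.indicator_of_mem (by exact hy),
        Set.indicator_of_mem (by exact lt_add_of_pos_right x hy)]
    · rw [Set.indicator_of_notMem (by exact hy),
        Set.indicator_of_notMem (by simpa using hy)]
  have hI0 : IntegrableOn φ (Set.Ioi 0) := by
    have := (integrable_expMeasure_iff hρ _).1 (integrable_lipschitz_expMeasure hρ hh 0)
    simpa only [zero_add] using this
  have hIx : IntegrableOn φ (Set.Ioi x) := by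
    have h1 := (integrable_expMeasure_iff hρ _).1 (integrable_lipschitz_expMeasure hρ hh x)
    simp only [hsub] at h1
    have h2 := h1.const_mul (Real.exp (ρ * x))⁻¹
    simp only [inv_mul_cancel_left₀ (Real.exp_pos _).ne'] at h2
    have h3 : Integrable ((Set.Ioi 0).indicator fun y => φ (x + y)) :=
      (integrable_indicator_iff measurableSet_Ioi).2 h2
    rw [show ((Set.Ioi 0).indicator fun y => φ (x + y)) =
      fun y => (Set.Ioi x).indicator φ (x + y) from funext hind] at h3
    have h4 := (h3.comp_add_left (-x))
    simp only [add_neg_cancel_left] at h4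
    exact (integrable_indicator_iff measurableSet_Ioi).1 h4
  rw [integral_expMeasure hρ, integral_expMeasure hρ]
  simp only [hsub]
  rw [integral_const_mul]
  congr 1
  rw [← integral_indicator measurableSet_Ioi]
  simp only [hind]
  rw [integral_add_left_eq_self (fun u => (Set.Ioi x).indicator φ u) x,
    integral_indicator measurableSet_Ioi, ← intervalIntegral.integral_Ioi_sub_Ioi' hI0 hIx]
  ring

theorem abs_sub_le_of_hasDerivAt {φ φ' : ℝ → ℝ} {x d C : ℝ} (hφ : ∀ t, HasDerivAt φ (φ' t) t)
    (hC : ∀ t, |t - x| ≤ |d| → |φ' t| ≤ C) : |φ (x + d) - φ x| ≤ C * |d| := by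
  have := (convex_closedBall x |d|).norm_image_sub_le_of_norm_hasDerivWithin_le (f := φ)
    (f' := φ') (C := C) (x := x) (y := x + d)
    (fun t _ => (hφ t).hasDerivWithinAt)
    (fun t ht => hC t (by rwa [Metric.mem_closedBall, Real.dist_eq] at ht))
    (Metric.mem_closedBall_self (abs_nonneg d)) (by simp)
  simpa using this

/-- The derivative of the solution of the Stein equation `f'' / ρ - f' = h - E h(Z)` of the
exponential law of `Z` with rate `ρ`, namely `f' x = E h(Z) - E h(x + Z)`. -/
def steinDeriv (ρ : ℝ) (h : ℝ → ℝ) (x : ℝ) : ℝ :=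
  ∫ y, h y ∂(expMeasure ρ) - ∫ y, h (x + y) ∂(expMeasure ρ)

/-- The solution of the Stein equation vanishing at `0` together with its derivative. -/
def steinSol (ρ : ℝ) (h : ℝ → ℝ) (x : ℝ) : ℝ := ∫ t in (0 : ℝ)..x, steinDeriv ρ h t

theorem steinDeriv_zero (ρ : ℝ) (h : ℝ → ℝ) : steinDeriv ρ h 0 = 0 := by simp [steinDeriv]

variable (hρ : 0 < ρ) {h : ℝ → ℝ} (hh : LipschitzWith 1 h)

include hρ hh

theorem abs_steinDeriv_sub_le (x y : ℝ) : |steinDeriv ρ h x - steinDeriv ρ h y| ≤ |x - y| := by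
  have := isProbabilityMeasure_expMeasure hρ
  unfold steinDeriv
  rw [sub_sub_sub_cancel_left, ← integral_sub (integrable_lipschitz_expMeasure hρ hh y)
    (integrable_lipschitz_expMeasure hρ hh x), ← Real.norm_eq_abs]
  refine (norm_integral_le_of_norm_le_const (C := |x - y|)
    (Eventually.of_forall fun z => ?_)).trans (by simp)
  have := hh.dist_le_mul (y + z) (x + z)
  rw [Real.dist_eq, Real.dist_eq, add_sub_add_right_eq_sub, abs_sub_comm y x] at this
  simpa using this

theorem hasDerivAt_steinDeriv (x : ℝ) : HasDerivAt (steinDeriv ρ h)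
    (ρ * (steinDeriv ρ h x + h x - ∫ y, h y ∂(expMeasure ρ))) x := by
  set I := ∫ y, h y ∂(expMeasure ρ) with hI
  have hcont : Continuous fun u => ρ * Real.exp (-(ρ * u)) * h u := by
    have := hh.continuous
    fun_prop
  have h1 : HasDerivAt (fun x => ∫ u in (0 : ℝ)..x, ρ * Real.exp (-(ρ * u)) * h u)
      (ρ * Real.exp (-(ρ * x)) * h x) x :=
    intervalIntegral.integral_hasDerivAt_right (hcont.intervalIntegrable _ _)
      hcont.aestronglyMeasurable.stronglyMeasurableAtFilter hcont.continuousAt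
  have h2 : HasDerivAt (fun x => Real.exp (ρ * x)) (Real.exp (ρ * x) * ρ) x := by
    simpa using ((hasDerivAt_id x).const_mul ρ).exp
  have h3 := (h2.mul (h1.const_sub I)).const_sub I
  have h4 : steinDeriv ρ h = fun x => I - Real.exp (ρ * x) *
      (I - ∫ u in (0 : ℝ)..x, ρ * Real.exp (-(ρ * u)) * h u) := by
    ext x
    rw [steinDeriv, integral_add_expMeasure hρ hh]
  have h5 : Real.exp (ρ * x) * Real.exp (-(ρ * x)) = 1 := by rw [← Real.exp_add]; simp
  rw [h4]
  refine h3.congr_deriv ?_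
  linear_combination (ρ * h x) * h5

/-- The second derivative of the Stein solution is bounded by `1`, its first derivative being
1-Lipschitz. -/
theorem abs_deriv_steinDeriv_le (x : ℝ) :
    |ρ * (steinDeriv ρ h x + h x - ∫ y, h y ∂(expMeasure ρ))| ≤ 1 := by
  have h1 : LipschitzWith 1 (steinDeriv ρ h) := LipschitzWith.of_dist_le_mul fun x y => by
    simpa [Real.dist_eq] using abs_steinDeriv_sub_le hρ hh x y
  have := norm_deriv_le_of_lipschitz (x₀ := x) h1
  rwa [(hasDerivAt_steinDeriv hρ hh x).deriv] at this

theorem hasDerivAt_steinSol (x : ℝ) : HasDerivAt (steinSol ρ h) (steinDeriv ρ h x) x := by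
  have hcont : Continuous (steinDeriv ρ h) :=
    continuous_iff_continuousAt.2 fun x => (hasDerivAt_steinDeriv hρ hh x).continuousAt
  exact intervalIntegral.integral_hasDerivAt_right (hcont.intervalIntegrable _ _)
      hcont.aestronglyMeasurable.stronglyMeasurableAtFilter hcont.continuousAt

theorem steinSol_taylor_one (x d : ℝ) :
    |steinSol ρ h (x + d) - steinSol ρ h x - steinDeriv ρ h x * d| ≤ d ^ 2 := by
  have := abs_sub_le_of_hasDerivAt (φ := fun t => steinSol ρ h t - steinDeriv ρ h x * t)
    (φ' := fun t => steinDeriv ρ h t - steinDeriv ρ h x) (x := x) (d := d) (C := |d|)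
    (fun t => ((hasDerivAt_steinSol hρ hh t).sub
      ((hasDerivAt_id' t).const_mul (steinDeriv ρ h x))).congr_deriv (by ring))
    (fun t ht => (abs_steinDeriv_sub_le hρ hh t x).trans ht)
  rw [← sq, sq_abs] at this
  convert this using 2
  ring

theorem steinSol_taylor_two (x d : ℝ) :
    |steinSol ρ h (x + d) - steinSol ρ h x - steinDeriv ρ h x * d -
      ρ * (steinDeriv ρ h x + h x - ∫ y, h y ∂(expMeasure ρ)) * (d ^ 2 / 2)| ≤
        2 * ρ * |d| ^ 3 := by
  set I := ∫ y, h y ∂(expMeasure ρ) with hI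
  set g := steinDeriv ρ h with hg
  set g' : ℝ → ℝ := fun t => ρ * (g t + h t - I) with hg'
  have hg'lip : ∀ t, |t - x| ≤ |d| → |g' t - g' x| ≤ 2 * ρ * |d| := by
    intro t ht
    have h1 := abs_steinDeriv_sub_le hρ hh t x
    have h2 := hh.dist_le_mul t x
    rw [Real.dist_eq, Real.dist_eq, NNReal.coe_one, one_mul] at h2
    have : g' t - g' x = ρ * ((g t - g x) + (h t - h x)) := by simp only [hg']; ring
    rw [this, abs_mul, abs_of_pos hρ]
    have h3 := abs_add_le (g t - g x) (h t - h x)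
    rw [mul_comm 2 ρ, mul_assoc]
    exact mul_le_mul_of_nonneg_left (by linarith) hρ.le
  have h1 : ∀ t, |t - x| ≤ |d| → |g t - g x - g' x * (t - x)| ≤ 2 * ρ * |d| * |d| := by
    intro t ht
    have := abs_sub_le_of_hasDerivAt (φ := fun t => g t - g' x * t)
      (φ' := fun t => g' t - g' x) (x := x) (d := t - x) (C := 2 * ρ * |d|)
      (fun t => ((hasDerivAt_steinDeriv hρ hh t).sub
        ((hasDerivAt_id' t).const_mul (g' x))).congr_deriv (by rw [mul_one]))
      (fun s hs => hg'lip s (hs.trans ht))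
    rw [add_sub_cancel] at this
    calc |g t - g x - g' x * (t - x)| = |g t - g' x * t - (g x - g' x * x)| := by
          congr 1; ring
      _ ≤ _ := this
      _ ≤ _ := by gcongr
  have h2 := abs_sub_le_of_hasDerivAt
      (φ := fun t => steinSol ρ h t - g x * t - g' x * ((t - x) ^ 2 / 2))
      (φ' := fun t => g t - g x - g' x * (t - x)) (x := x) (d := d) (C := 2 * ρ * |d| * |d|)
      (fun t => by
        have e1 : HasDerivAt (fun t => (t - x) ^ 2 / 2) (t - x) t := by
          have := (((hasDerivAt_id' t).sub_const x).pow 2).div_const 2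
          refine this.congr_deriv ?_
          simp
        exact (((hasDerivAt_steinSol hρ hh t).sub ((hasDerivAt_id' t).const_mul (g x))).sub
          (e1.const_mul (g' x))).congr_deriv (by rw [mul_one])) h1
  refine le_trans (le_of_eq ?_) (h2.trans (le_of_eq (by ring)))
  congr 1
  ring

end Exponential

/-! ### The Stein bound for a fixed number of servers -/

namespace System.Regular

variable {sys : System N} {γ c K : ℝ} (H : sys.Regular γ c K)

include H

/-- Taylor expansion of the Stein solution along one step of the chain. -/
theorem abs_steinSol_step_sub_le {ρ : ℝ} (hρ : 0 < ρ) {h : ℝ → ℝ} (hh : LipschitzWith 1 h)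
    {η τ r : ℝ} (hη : 0 < η) (hτ : 0 < τ) (hr : 1 ≤ r) {Q : Fin N → ℕ}
    {ω : Fin N × ℕ × (Fin N → ℕ)} (hω : ω ∈ (sys.noise Q).support) :
    |steinSol ρ h (η * total (nextQueue Q ω.1 ω.2.1 ω.2.2)) - steinSol ρ h (η * total Q) -
      steinDeriv ρ h (η * total Q) * η * ((ω.2.1 : ℝ) - total ω.2.2) -
      ρ * (steinDeriv ρ h (η * total Q) + h (η * total Q) - ∫ y, h y ∂(expMeasure ρ)) *
        (η ^ 2 / 2) * ((ω.2.1 : ℝ) - total ω.2.2) ^ 2| ≤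
      η ^ 2 * (K * N) * (τ + 1) * (∑ i, unused Q ω.1 ω.2.1 ω.2.2 i) +
        η ^ 2 * (K * N) ^ 2 * τ ^ (1 - r) * gap γ K (nextQueue Q ω.1 ω.2.1 ω.2.2) ^ r +
        2 * ρ * η ^ 3 * (K * N) * ((ω.2.1 : ℝ) - total ω.2.2) ^ 2 := by
  obtain ⟨ha, hs⟩ := sys.mem_support_of_mem_support_noise Q hω
  have ha := H.arr_le _ ha
  have hs := H.svc_le _ hs
  have hM0 := H.scale_pos
  have hor := total_mul_unused_le (b := gapScale K N) H.γ_pos H.γ_le H.one_le_mul Q ω.1 ω.2.1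
      ω.2.2
  have hU0 := sum_unused_nonneg (Q := Q) (j := ω.1) (a := ω.2.1) (s := ω.2.2)
  have hUM := sum_unused_le (Q := Q) (j := ω.1) (a := ω.2.1) hs
  have hTn := total_nextQueue Q ω.1 ω.2.1 ω.2.2
  have hT0 := total_nonneg (nextQueue Q ω.1 ω.2.1 ω.2.2)
  have hd : |(ω.2.1 : ℝ) - total ω.2.2| ≤ K * N := by
    rw [abs_le]
    have h1 := total_le_of_le hs
    have h2 := total_nonneg ω.2.2
    have h3 : (0 : ℝ) ≤ ω.2.1 := Nat.cast_nonneg _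
    constructor <;> linarith
  have hL0 := gap_nonneg γ K (nextQueue Q ω.1 ω.2.1 ω.2.2)
  change _ ∨ _ ≤ K * N * gap γ K (nextQueue Q ω.1 ω.2.1 ω.2.2) at hor
  set T' := total (nextQueue Q ω.1 ω.2.1 ω.2.2)
  set L' := gap γ K (nextQueue Q ω.1 ω.2.1 ω.2.2)
  set U := ∑ i, unused Q ω.1 ω.2.1 ω.2.2 i
  set d := (ω.2.1 : ℝ) - total ω.2.2
  set M := K * N
  set X := η * total Q with hX
  set f := steinSol ρ h
  set g := steinDeriv ρ h with hg
  have h1 := steinSol_taylor_two hρ hh X (η * d)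
  have h2 := steinSol_taylor_one hρ hh (η * T') (-(η * U))
  have h3 : η * T' + -(η * U) = X + η * d := by rw [hTn, hX]; ring
  rw [h3] at h2
  have h4 : |g (η * T')| ≤ η * T' := by
    have := abs_steinDeriv_sub_le hρ hh (η * T') 0
    rwa [steinDeriv_zero, sub_zero, sub_zero, abs_of_nonneg (mul_nonneg hη.le hT0)] at this
  -- the wasted service contributes through the product of the queue length and the unused service
  have h5 : T' * U ≤ M * (τ * U + M * τ ^ (1 - r) * L' ^ r) := by
    rcases hor with h | h
    · rw [h]; simp only [mul_zero, zero_add]; positivity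
    · calc T' * U ≤ M * L' * U := mul_le_mul_of_nonneg_right h hU0
        _ = M * (L' * U) := by ring
        _ ≤ _ := mul_le_mul_of_nonneg_left (mul_le_add_rpow hτ hr hL0 hU0 hUM) hM0.le
  have h6 : |g (η * T') * (η * U)| ≤ η ^ 2 * (M * (τ * U + M * τ ^ (1 - r) * L' ^ r)) := by
    rw [abs_mul, abs_of_nonneg (mul_nonneg hη.le hU0)]
    calc _ ≤ η * T' * (η * U) := by gcongr
      _ = η ^ 2 * (T' * U) := by ring
      _ ≤ _ := by gcongr
  have h7 : (-(η * U)) ^ 2 ≤ η ^ 2 * (M * U) := by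
    have : U * U ≤ M * U := mul_le_mul_of_nonneg_right hUM hU0
    calc (-(η * U)) ^ 2 = η ^ 2 * (U * U) := by ring
      _ ≤ _ := by gcongr
  have h8 : 2 * ρ * |η * d| ^ 3 ≤ 2 * ρ * η ^ 3 * M * d ^ 2 := by
    rw [abs_mul, abs_of_pos hη]
    calc 2 * ρ * (η * |d|) ^ 3 = 2 * ρ * η ^ 3 * (|d| * |d| ^ 2) := by ring
      _ ≤ 2 * ρ * η ^ 3 * (M * |d| ^ 2) := by gcongr
      _ = _ := by rw [sq_abs]; ring
  have h1' := abs_le.1 h1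
  have h2' := abs_le.1 h2
  have h6' := abs_le.1 h6
  rw [abs_le]
  constructor <;> linarith [h1'.1, h1'.2, h2'.1, h2'.2, h6'.1, h6'.2]

/-- One step of the chain, averaged: the generator of the chain acting on the Stein solution is
`η ε (h - E h(Z))` up to a small error. -/
theorem abs_integral_steinSol_step_sub_le {ρ : ℝ} (hρ : 0 < ρ) {h : ℝ → ℝ}
    (hh : LipschitzWith 1 h) {η τ r : ℝ} (hη : 0 < η) (hτ : 0 < τ) (hr : 1 ≤ r)
    (hvar : η * (sys.arrVar + sys.svcVar) * ρ = 2 * sys.slack) (Q : Fin N → ℕ) :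
    |∫ x, steinSol ρ h (η * total x) ∂(sys.step Q).toMeasure - steinSol ρ h (η * total Q) -
      η * sys.slack * (h (η * total Q) - ∫ y, h y ∂(expMeasure ρ))| ≤
      η ^ 2 * (K * N) * (τ + 1) * sys.meanUnused Q +
        η ^ 2 * (K * N) ^ 2 * τ ^ (1 - r) * ∫ x, gap γ K x ^ r ∂(sys.step Q).toMeasure +
        (2 * ρ * η ^ 3 * (K * N) * (sys.arrVar + sys.svcVar + sys.slack ^ 2) +
          η ^ 2 * sys.slack ^ 2 / 2) := by
  have hi := H.integrable_noise Q
  have hpt := fun ω hω => H.abs_steinSol_step_sub_le hρ hh hη hτ hr (Q := Q) (ω := ω) hω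
  set I := ∫ y, h y ∂(expMeasure ρ)
  set ε := sys.slack with hε
  set V := sys.arrVar + sys.svcVar
  set X := η * total Q
  set g := steinDeriv ρ h X
  set g' := ρ * (g + h X - I) with hg'
  set M := K * N
  have hup := integral_pmf_mono (hi _) (hi _) fun ω hω => (abs_le.1 (hpt ω hω)).2
  have hlo := integral_pmf_mono (hi _) (hi _) fun ω hω => (abs_le.1 (hpt ω hω)).1
  rw [integral_neg] at hlo
  have e1 := H.integral_net_input Q
  have e2 := H.integral_net_input_sq Q
  have eL : ∫ ω, (steinSol ρ h (η * total (nextQueue Q ω.1 ω.2.1 ω.2.2)) - steinSol ρ h X -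
      g * η * ((ω.2.1 : ℝ) - total ω.2.2) -
      g' * (η ^ 2 / 2) * ((ω.2.1 : ℝ) - total ω.2.2) ^ 2) ∂(sys.noise Q).toMeasure =
      ∫ x, steinSol ρ h (η * total x) ∂(sys.step Q).toMeasure - steinSol ρ h X + g * η * ε -
        g' * (η ^ 2 / 2) * (V + ε ^ 2) := by
    rw [integral_sub (hi _) (hi _), integral_sub (hi _) (hi _), integral_sub (hi _) (hi _),
      integral_const_mul, integral_const_mul, e1, e2, sys.integral_step]
    simp only [integral_const, probReal_univ, one_smul]
    ring
  have eR : ∫ ω, (η ^ 2 * M * (τ + 1) * (∑ i, unused Q ω.1 ω.2.1 ω.2.2 i) +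
        η ^ 2 * M ^ 2 * τ ^ (1 - r) * gap γ K (nextQueue Q ω.1 ω.2.1 ω.2.2) ^ r +
        2 * ρ * η ^ 3 * M * ((ω.2.1 : ℝ) - total ω.2.2) ^ 2) ∂(sys.noise Q).toMeasure =
      η ^ 2 * M * (τ + 1) * sys.meanUnused Q +
        η ^ 2 * M ^ 2 * τ ^ (1 - r) * ∫ x, gap γ K x ^ r ∂(sys.step Q).toMeasure +
        2 * ρ * η ^ 3 * M * (V + ε ^ 2) := by
    rw [integral_add (hi _) (hi _), integral_add (hi _) (hi _), integral_const_mul,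
      integral_const_mul, integral_const_mul, e2, sys.integral_step]
    rfl
  rw [eL, eR] at hup hlo
  -- the Stein equation, multiplied by `η ε`
  have hgen : g' * (η ^ 2 / 2) * V = η * ε * (g + h X - I) := by
    have : g' * (η ^ 2 / 2) * V = (η * V * ρ) * (η / 2 * (g + h X - I)) := by rw [hg']; ring
    rw [this, hvar]; ring
  have hg'1 : |g' * (η ^ 2 / 2) * ε ^ 2| ≤ η ^ 2 * ε ^ 2 / 2 := by
    have h1 : |g'| ≤ 1 := abs_deriv_steinDeriv_le hρ hh X
    rw [abs_mul, abs_mul, abs_of_nonneg (by positivity : 0 ≤ η ^ 2 / 2),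
      abs_of_nonneg (sq_nonneg ε)]
    calc |g'| * (η ^ 2 / 2) * ε ^ 2 ≤ 1 * (η ^ 2 / 2) * ε ^ 2 := by gcongr
      _ = _ := by ring
  have hg'2 := abs_le.1 hg'1
  rw [abs_le]
  constructor <;> linarith [hg'2.1, hg'2.2]

variable {π : PMF (Fin N → ℕ)} (hπ : sys.IsStationary π)

include hπ

/-- The generator comparison in steady state: the mean one-step change of the Stein solution
vanishes, so that only the mean errors remain. -/
theorem abs_integral_lipschitz_sub_le {ρ : ℝ} (hρ : 0 < ρ) {h : ℝ → ℝ}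
    (hh : LipschitzWith 1 h) {η τ r : ℝ} (hη : 0 < η) (hτ : 0 < τ) (hr : 1 ≤ r)
    (hvar : η * (sys.arrVar + sys.svcVar) * ρ = 2 * sys.slack) :
    η * sys.slack * |∫ Q, h (η * total Q) ∂π.toMeasure - ∫ y, h y ∂(expMeasure ρ)| ≤
      η ^ 2 * (K * N) * (τ + 1) * sys.slack +
        η ^ 2 * (K * N) ^ 2 * τ ^ (1 - r) * (8 * (r / gapRate K N) ^ r) +
        (2 * ρ * η ^ 3 * (K * N) * (sys.arrVar + sys.svcVar + sys.slack ^ 2) +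
          η ^ 2 * sys.slack ^ 2 / 2) := by
  have hM0 := H.scale_pos
  have hε0 := H.slack_pos
  have hTi := H.integrable_total hπ
  have hfi : Integrable (fun Q => steinSol ρ h (η * total Q)) π.toMeasure := by
    refine ((H.integrable_total_sq hπ).const_mul (η ^ 2)).mono'
      Measurable.of_discrete.aestronglyMeasurable (Eventually.of_forall fun Q => ?_)
    have := steinSol_taylor_one hρ hh 0 (η * total Q)
    rw [zero_add, steinDeriv_zero, zero_mul, sub_zero, mul_pow] at this
    rw [Real.norm_eq_abs]
    simpa [steinSol] using this
  have hhi : Integrable (fun Q => h (η * total Q)) π.toMeasure := by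
    refine ((integrable_const |h 0|).add (hTi.const_mul η)).mono'
      Measurable.of_discrete.aestronglyMeasurable (Eventually.of_forall fun Q => ?_)
    have h1 := hh.dist_le_mul (η * total Q) 0
    have h0 : 0 ≤ η * total Q := mul_nonneg hη.le (total_nonneg Q)
    rw [Real.dist_eq, Real.dist_eq, sub_zero, abs_of_nonneg h0, NNReal.coe_one, one_mul] at h1
    rw [Real.norm_eq_abs, Pi.add_apply]
    have := abs_sub_abs_le_abs_sub (h (η * total Q)) (h 0)
    linarith
  obtain ⟨hgi, hgle⟩ := H.integral_gap_rpow_le hπ (r := r) (by linarith)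
  have hfs := hπ.integrable_step hfi
  have hgs := hπ.integrable_step hgi
  have hU := H.integrable_meanUnused π
  have hI : Integrable (fun Q => ∫ x, steinSol ρ h (η * total x) ∂(sys.step Q).toMeasure -
      steinSol ρ h (η * total Q)) π.toMeasure := hfs.sub hfi
  have hJ : Integrable (fun Q => h (η * total Q) - ∫ y, h y ∂(expMeasure ρ)) π.toMeasure :=
    hhi.sub (integrable_const _)
  have hJ' := hJ.const_mul (η * sys.slack)
  have hpt := H.abs_integral_steinSol_step_sub_le hρ hh hη hτ hr hvar
  have h1 : |∫ Q, (∫ x, steinSol ρ h (η * total x) ∂(sys.step Q).toMeasure -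
      steinSol ρ h (η * total Q) -
      η * sys.slack * (h (η * total Q) - ∫ y, h y ∂(expMeasure ρ))) ∂π.toMeasure| ≤ _ :=
    (abs_integral_le_integral_abs.trans (integral_mono (hI.sub hJ').abs
      (((hU.const_mul _).add (hgs.const_mul _)).add (integrable_const _)) hpt))
  have hUc := hU.const_mul (η ^ 2 * (K * N) * (τ + 1))
  have hgc := hgs.const_mul (η ^ 2 * (K * N) ^ 2 * τ ^ (1 - r))
  have hUg : Integrable (fun Q => η ^ 2 * (K * N) * (τ + 1) * sys.meanUnused Q +
      η ^ 2 * (K * N) ^ 2 * τ ^ (1 - r) * ∫ x, gap γ K x ^ r ∂(sys.step Q).toMeasure)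
      π.toMeasure := hUc.add hgc
  simp only [Pi.add_apply] at h1
  rw [integral_sub hI hJ', integral_sub hfs hfi, hπ.integral_step hfi, sub_self, zero_sub,
    abs_neg, integral_const_mul, integral_sub hhi (integrable_const _),
    integral_add hUg (integrable_const _), integral_add hUc hgc,
    integral_const_mul, integral_const_mul, hπ.integral_step hgi,
    H.integral_meanUnused hπ] at h1
  simp only [integral_const, probReal_univ, one_smul] at h1
  rw [abs_mul, abs_of_pos (by positivity)] at h1
  refine h1.trans ?_
  have : η ^ 2 * (K * N) ^ 2 * τ ^ (1 - r) * ∫ x, gap γ K x ^ r ∂π.toMeasure ≤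
      η ^ 2 * (K * N) ^ 2 * τ ^ (1 - r) * (8 * (r / gapRate K N) ^ r) :=
    mul_le_mul_of_nonneg_left hgle (by positivity)
  linarith

end System.Regular

/-! ### Many-server heavy traffic -/

theorem integral_scaledTotal (β : ℝ) (p : PMF (Fin N → ℕ)) {h : ℝ → ℝ} (hh : Continuous h) :
    ∫ x, h x ∂(scaledTotal β p) = ∫ Q, h ((N : ℝ) ^ (-β) * total Q) ∂p.toMeasure := by
  unfold scaledTotal
  rw [integral_map Measurable.of_discrete.aemeasurable hh.aestronglyMeasurable]
  rfl

instance isProbabilityMeasure_scaledTotal (β : ℝ) (p : PMF (Fin N → ℕ)) :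
    IsProbabilityMeasure (scaledTotal β p) :=
  Measure.isProbabilityMeasure_map Measurable.of_discrete.aemeasurable

/-- The constant of the Wasserstein bound. -/
def rateConst (K s r : ℝ) : ℝ :=
  2 * K + 8 * K ^ 2 * (128 * r * K ^ 3) ^ r + 2 * (2 / s) * K * (s + 1) + 1

namespace System.Regular

variable {sys : System N} {γ c K : ℝ} (H : sys.Regular γ c K)

include H

/-- A positive probability of no arrival rules out a deterministic number of arrivals, since the
arrival rate is positive. In particular the limiting exponential law is not degenerate. -/
theorem arrVar_ne_zero (h0 : sys.arr 0 ≠ 0) : sys.arrVar ≠ 0 := by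
  intro hv
  have hm : AEMeasurable (fun a : ℕ => (a : ℝ)) sys.arr.toMeasure :=
    Measurable.of_discrete.aemeasurable
  rw [arrVar, variance_eq_integral hm, integral_eq_zero_iff_of_nonneg
    (fun a => sq_nonneg _) (H.integrable_arr _), Filter.EventuallyEq, ae_iff,
    PMF.toMeasure_apply_eq_zero_iff _ (MeasurableSet.of_discrete)] at hv
  have h1 := Set.disjoint_left.1 hv ((PMF.mem_support_iff _ _).2 h0)
  have h2 : sys.lambdaSum = 0 := by
    simpa [lambdaSum] using h1
  have h3 := H.rate
  have h4 := H.lt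
  have hK := H.one_le
  have : 0 < 1 / K := by positivity
  rw [h2] at h3 h4
  linarith

variable {π : PMF (Fin N → ℕ)} (hπ : sys.IsStationary π)

include hπ

theorem wassersteinDist_le {α s r : ℝ} {k : ℕ} (hα : 1 < α) (hs : 0 < s) (hr : 2 ≤ r)
    (hε : sys.slack = (N : ℝ) ^ (1 - α)) (hV : sys.arrVar + sys.svcVar = (N : ℝ) ^ k * s) :
    wassersteinDist (scaledTotal (α - 1 + k) π) (expMeasure (2 / s)) ≤
      ENNReal.ofReal (rateConst K s r * (N : ℝ) ^ (5 - k - α + (α - 1) / r)) := by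
  refine iSup₂_le fun h hh => ENNReal.ofReal_le_ofReal ?_
  rw [integral_scaledTotal _ _ hh.continuous]
  set x : ℝ := (N : ℝ) with hx
  have hx1 : 1 ≤ x := by rw [hx]; exact_mod_cast H.pos
  have hx0 : 0 < x := by linarith
  have hK := H.one_le
  have hK0 : 0 < K := by linarith
  have hr0 : 0 < r := by linarith
  have hVk : x ^ k = x ^ (k : ℝ) := (Real.rpow_natCast x k).symm
  set η := x ^ (-(α - 1 + k)) with hη
  -- this threshold balances the two terms with `τ` in the bound for the unused service
  set τ := x ^ (5 / 2 + α / r) with hτ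
  have hη0 : 0 < η := Real.rpow_pos_of_pos hx0 _
  have hτ0 : 0 < τ := Real.rpow_pos_of_pos hx0 _
  have hηk : η * x ^ k = x ^ (1 - α) := by
    rw [hη, hVk, ← Real.rpow_add hx0]; congr 1; ring
  have hmain := H.abs_integral_lipschitz_sub_le hπ (ρ := 2 / s) (by positivity) hh hη0 hτ0
    (r := r) (by linarith) (by
      rw [hV, hε, ← mul_assoc, hηk]; field_simp)
  rw [hV, hε, ← hx] at hmain
  set A := |∫ Q, h (η * total Q) ∂π.toMeasure - ∫ y, h y ∂(expMeasure (2 / s))|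
  set ε := x ^ (1 - α) with hε'
  have hε0 : 0 < ε := Real.rpow_pos_of_pos hx0 _
  set p := 5 - (k : ℝ) - α + (α - 1) / r with hp
  have hrinv : 1 / r ≤ 1 / 2 := one_div_le_one_div_of_le (by norm_num) hr
  have hαr : 0 ≤ α / r := by positivity
  have hαr' : (α - 1) / r = α / r - 1 / r := by ring
  have hk0 : (0 : ℝ) ≤ k := Nat.cast_nonneg k
  have htgt : η * ε * x ^ p = x ^ (-(α - 1 + k) + (1 - α) + p) := by
    rw [hη, hε', ← Real.rpow_add hx0, ← Real.rpow_add hx0]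
  have hcmp : ∀ y : ℝ, y ≤ -(α - 1 + k) + (1 - α) + p → x ^ y ≤ η * ε * x ^ p := by
    intro y hy
    rw [htgt]
    exact Real.rpow_le_rpow_of_exponent_le hx1 hy
  have hη2 : η ^ 2 = x ^ (-2 * (α - 1 + k)) := by
    rw [hη, ← Real.rpow_natCast, ← Real.rpow_mul hx0.le]; congr 1; push_cast; ring
  have hη3 : η ^ 3 = x ^ (-3 * (α - 1 + k)) := by
    rw [hη, ← Real.rpow_natCast, ← Real.rpow_mul hx0.le]; congr 1; push_cast; ring
  have hε2 : ε ^ 2 = x ^ (2 * (1 - α)) := by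
    rw [hε', ← Real.rpow_natCast, ← Real.rpow_mul hx0.le]; congr 1; push_cast; ring
  have hx2 : x ^ 2 = x ^ (2 : ℝ) := (Real.rpow_two x).symm
  have t1 : η ^ 2 * x * τ * ε ≤ η * ε * x ^ p := by
    have : η ^ 2 * x * τ * ε =
        x ^ (-2 * (α - 1 + k) + 1 + (5 / 2 + α / r) + (1 - α)) := by
      rw [Real.rpow_add hx0, Real.rpow_add hx0, Real.rpow_add hx0, Real.rpow_one, hη2]
    rw [this]
    refine hcmp _ ?_
    rw [hp, hαr']; linarith
  have t2 : η ^ 2 * x * ε ≤ η * ε * x ^ p := by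
    have : η ^ 2 * x * ε = x ^ (-2 * (α - 1 + k) + 1 + (1 - α)) := by
      rw [Real.rpow_add hx0, Real.rpow_add hx0, Real.rpow_one, hη2]
    rw [this]
    refine hcmp _ ?_
    rw [hp, hαr']; linarith
  have hgap : (r / gapRate K N) ^ r = (128 * r * K ^ 3) ^ r * x ^ (5 / 2 * r) := by
    have h1 : r / gapRate K N = 128 * r * K ^ 3 * x ^ (5 / 2 : ℝ) := by
      have : x ^ (5 / 2 : ℝ) = x ^ 2 * √x := by
        rw [Real.sqrt_eq_rpow, hx2, ← Real.rpow_add hx0]; norm_num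
      rw [this, gapRate, gapScale, ← hx]
      simp only [one_div, div_inv_eq_mul]
      ring
    rw [h1, Real.mul_rpow (by positivity) (by positivity), ← Real.rpow_mul hx0.le]
  have t3 : η ^ 2 * x ^ 2 * τ ^ (1 - r) * x ^ (5 / 2 * r) ≤ η * ε * x ^ p := by
    have : η ^ 2 * x ^ 2 * τ ^ (1 - r) * x ^ (5 / 2 * r) =
        x ^ (-2 * (α - 1 + k) + 2 + (5 / 2 + α / r) * (1 - r) + 5 / 2 * r) := by
      rw [Real.rpow_add hx0, Real.rpow_add hx0, Real.rpow_add hx0, hη2, hx2, hτ,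
        ← Real.rpow_mul hx0.le]
    rw [this]
    refine hcmp _ ?_
    have h2 : (5 / 2 + α / r) * (1 - r) = 5 / 2 + α / r - 5 / 2 * r - α := by field_simp; ring
    rw [hp, hαr', h2]; linarith
  have t4 : η ^ 3 * x * x ^ k ≤ η * ε * x ^ p := by
    have : η ^ 3 * x * x ^ k = x ^ (-3 * (α - 1 + k) + 1 + k) := by
      rw [Real.rpow_add hx0, Real.rpow_add hx0, Real.rpow_one, hη3, hVk]
    rw [this]
    refine hcmp _ ?_
    rw [hp, hαr']; linarith
  have t5 : η ^ 3 * x * ε ^ 2 ≤ η * ε * x ^ p := by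
    have : η ^ 3 * x * ε ^ 2 = x ^ (-3 * (α - 1 + k) + 1 + 2 * (1 - α)) := by
      rw [Real.rpow_add hx0, Real.rpow_add hx0, Real.rpow_one, hη3, hε2]
    rw [this]
    refine hcmp _ ?_
    rw [hp, hαr']; linarith
  have t6 : η ^ 2 * ε ^ 2 ≤ η * ε * x ^ p := by
    have : η ^ 2 * ε ^ 2 = x ^ (-2 * (α - 1 + k) + 2 * (1 - α)) := by
      rw [Real.rpow_add hx0, hη2, hε2]
    rw [this]
    refine hcmp _ ?_
    rw [hp, hαr']; linarith
  have hbound : η * ε * A ≤ η * ε * (rateConst K s r * x ^ p) := by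
    refine hmain.trans ?_
    rw [hgap]
    unfold rateConst
    set D := (128 * r * K ^ 3) ^ r
    have hD : 0 ≤ D := by positivity
    have u1 := mul_le_mul_of_nonneg_left t1 hK0.le
    have u2 := mul_le_mul_of_nonneg_left t2 hK0.le
    have u3 := mul_le_mul_of_nonneg_left t3 (by positivity : 0 ≤ 8 * K ^ 2 * D)
    have u4 := mul_le_mul_of_nonneg_left t4 (by positivity : 0 ≤ 2 * (2 / s) * K * s)
    have u5 := mul_le_mul_of_nonneg_left t5 (by positivity : 0 ≤ 2 * (2 / s) * K)
    have u6 : 0 ≤ η ^ 2 * ε ^ 2 := by positivity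
    linarith
  exact le_of_mul_le_mul_left hbound (by positivity)

end System.Regular

theorem tendsto_pnat_rpow_neg {y : ℝ} (hy : y < 0) :
    Tendsto (fun N : ℕ+ => (N : ℝ) ^ y) atTop (𝓝 0) := by
  have h := (tendsto_rpow_neg_atTop (neg_pos.2 hy)).comp
    (tendsto_natCast_atTop_atTop.comp tendsto_PNat_val_atTop_atTop)
  simp only [neg_neg] at h
  exact h

/-- The asymptotic assumptions yield the quantitative ones with a constant not depending on `N`.
Here `α > 1` makes `ε = N ^ (1 - α)` negligible compared with `λ_Σ c / N`, which is of order `1`. -/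
theorem exists_eventually_regular (sys : ∀ N : ℕ+, System N) (Amax : ℕ+ → ℝ) (Smax : ℕ)
    (hA : ∀ᶠ N in atTop, ∀ a ∈ (sys N).arr.support, (a : ℝ) ≤ Amax N)
    (hS : ∀ᶠ N in atTop, ∀ s ∈ (sys N).svc.support, ∀ n, s n ≤ Smax)
    (α : ℝ) (hα : 1 < α)
    (hload : ∀ᶠ N : ℕ+ in atTop, (sys N).lambdaSum = (sys N).muSum - (N : ℝ) ^ (1 - α))
    (hmu : (fun N : ℕ+ => (N : ℝ)) =O[atTop] fun N : ℕ+ => (sys N).muSum)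
    (hAmax : Amax =O[atTop] fun N : ℕ+ => (N : ℝ))
    (γ c : ℝ) (hγ0 : 0 < γ) (hγ1 : γ ≤ 1) (hc : 0 < c)
    (hclass : ∀ᶠ N : ℕ+ in atTop, (sys N).InFlexibleClass γ (c / (N : ℝ))) :
    ∃ K, ∀ᶠ N : ℕ+ in atTop, (sys N).Regular γ c K := by
  obtain ⟨c1, hc1, hmu⟩ := hmu.exists_pos
  obtain ⟨c2, hc2, hAmax⟩ := hAmax.exists_pos
  have hδ : 0 < c / (2 * c1 * (c + 1)) := by positivity
  have hsmall := (tendsto_pnat_rpow_neg (y := 1 - α) (by linarith)).eventually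
    (eventually_le_nhds hδ)
  set K := max (max 1 (1 / γ)) (max (max c2 Smax) (2 * c1 / c)) with hK
  have k1 : 1 ≤ K := (le_max_left _ _).trans (le_max_left _ _)
  have k2 : 1 / γ ≤ K := (le_max_right _ _).trans (le_max_left _ _)
  have k3 : c2 ≤ K := ((le_max_left _ _).trans (le_max_left _ _)).trans (le_max_right _ _)
  have k4 : (Smax : ℝ) ≤ K := ((le_max_right _ _).trans (le_max_left _ _)).trans (le_max_right _ _)
  have k5 : 2 * c1 / c ≤ K := (le_max_right _ _).trans (le_max_right _ _)
  refine ⟨K, ?_⟩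
  filter_upwards [hA, hS, hload, hmu.bound, hAmax.bound, hclass, hsmall] with
    N hA hS hload hmu hAmax hclass hsmall
  have hN1 : (1 : ℝ) ≤ N := by exact_mod_cast N.pos
  have hN0 : (0 : ℝ) < N := by linarith
  have hmuS : 0 ≤ (sys N).muSum := Finset.sum_nonneg fun n _ => (sys N).mu_nonneg n
  rw [Real.norm_of_nonneg hN0.le, Real.norm_of_nonneg hmuS] at hmu
  rw [Real.norm_of_nonneg hN0.le] at hAmax
  set ε := (N : ℝ) ^ (1 - α) with hε
  have hε0 : 0 < ε := Real.rpow_pos_of_pos hN0 _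
  refine ⟨N.pos, hγ0, hγ1, k1, ?_, ?_, ?_, ?_, ?_, hclass⟩
  · rwa [div_le_iff₀ hγ0] at k2
  · intro a ha
    refine (hA a ha).trans ((le_abs_self _).trans (hAmax.trans ?_))
    gcongr
  · intro s hs n
    refine le_trans ?_ k4
    exact_mod_cast hS s hs n
  · rw [hload]; linarith
  · have h1 : (sys N).muSum - (sys N).lambdaSum = ε := by rw [hload]; ring
    rw [h1, hload]
    have h2 : 1 / K ≤ c / (2 * c1) := by
      rw [div_le_div_iff₀ (by linarith) (by positivity)]
      rw [div_le_iff₀ hc] at k5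
      linarith
    have h3 : c / c1 ≤ (sys N).muSum * (c / N) := by
      rw [mul_div_assoc', div_le_div_iff₀ hc1 hN0]
      nlinarith
    have h4 : ε * (c / N) ≤ ε * c := by
      gcongr
      exact div_le_self hc.le hN1
    have h5 : ε * (c + 1) ≤ c / (2 * c1) := by
      calc ε * (c + 1) ≤ c / (2 * c1 * (c + 1)) * (c + 1) := by gcongr
        _ = c / (2 * c1) := by field_simp
    have h6 : c / c1 = c / (2 * c1) + c / (2 * c1) := by field_simp; norm_num
    rw [sub_mul]
    linarith

theorem exists_rate {a b : ℝ} (ha : 0 ≤ a) (hb : b < 0) : ∃ r : ℝ, 2 ≤ r ∧ b + a / r < 0 := by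
  refine ⟨max 2 (2 * (a + 1) / -b), le_max_left _ _, ?_⟩
  have hr : 0 < max 2 (2 * (a + 1) / -b) := lt_max_of_lt_left (by norm_num)
  have h1 : 2 * (a + 1) / -b ≤ max 2 (2 * (a + 1) / -b) := le_max_right _ _
  rw [div_le_iff₀ (neg_pos.2 hb)] at h1
  have : a / max 2 (2 * (a + 1) / -b) < -b := by
    rw [div_lt_iff₀ hr]
    linarith
  linarith

theorem tendsto_ofReal_mul_rpow (C : ℝ) {y : ℝ} (hy : y < 0) :
    Tendsto (fun N : ℕ+ => ENNReal.ofReal (C * (N : ℝ) ^ y)) atTop (𝓝 0) := by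
  have := ENNReal.tendsto_ofReal ((tendsto_pnat_rpow_neg hy).const_mul C)
  simpa using this

/-- Convergence in the Wasserstein distance implies weak convergence. -/
theorem tendsto_integral_of_wassersteinDist {ι : Type*} {l : Filter ι} [l.IsCountablyGenerated]
    {P : ι → Measure ℝ} [∀ i, IsProbabilityMeasure (P i)] {P' : Measure ℝ}
    [IsProbabilityMeasure P'] (h : Tendsto (fun i => wassersteinDist (P i) P') l (𝓝 0))
    (f : BoundedContinuousFunction ℝ ℝ) :
    Tendsto (fun i => ∫ x, f x ∂(P i)) l (𝓝 (∫ x, f x ∂P')) := by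
  let ν : ι → ProbabilityMeasure ℝ := fun i => ⟨P i, inferInstance⟩
  let ν' : ProbabilityMeasure ℝ := ⟨P', inferInstance⟩
  have key : Tendsto ν l (𝓝 ν') := by
    rw [tendsto_iff_forall_lipschitz_integral_tendsto]
    rintro g - ⟨L, hL⟩
    change Tendsto (fun i => ∫ x, g x ∂(P i)) l (𝓝 (∫ x, g x ∂P'))
    set M : ℝ := L + 1 with hM
    have hM0 : 0 < M := by positivity
    have hg : LipschitzWith 1 fun x => M⁻¹ * g x := LipschitzWith.of_dist_le_mul fun x y => by
      have h1 := hL.dist_le_mul x y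
      have h2 : dist (M⁻¹ * g x) (M⁻¹ * g y) = M⁻¹ * dist (g x) (g y) := by
        rw [Real.dist_eq, Real.dist_eq, ← mul_sub, abs_mul, abs_of_pos (inv_pos.2 hM0)]
      rw [h2, NNReal.coe_one, one_mul, inv_mul_le_iff₀ hM0]
      refine h1.trans (mul_le_mul_of_nonneg_right (by linarith) dist_nonneg)
    have h1 : Tendsto (fun i => ENNReal.ofReal
        |(∫ x, M⁻¹ * g x ∂(P i)) - ∫ x, M⁻¹ * g x ∂P'|) l (𝓝 0) := by
      refine tendsto_of_tendsto_of_tendsto_of_le_of_le tendsto_const_nhds h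
        (fun i => zero_le) fun i => ?_
      exact le_iSup₂_of_le (fun x => M⁻¹ * g x) hg le_rfl
    have h2 := (ENNReal.tendsto_toReal ENNReal.zero_ne_top).comp h1
    simp only [Function.comp_def, ENNReal.toReal_ofReal (abs_nonneg _), ENNReal.toReal_zero,
      integral_const_mul] at h2
    have h3 := (tendsto_zero_iff_abs_tendsto_zero _).2 h2
    have h4 := (h3.const_mul M).add_const (∫ x, g x ∂P')
    simp only [mul_zero, zero_add] at h4
    refine h4.congr fun i => ?_
    field_simp
    ring
  exact ProbabilityMeasure.tendsto_iff_forall_integral_tendsto.1 key f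

theorem exists_eventually_wassersteinDist_le (sys : ∀ N : ℕ+, System N)
    (π : ∀ N : ℕ+, PMF (Fin N → ℕ)) (hπ : ∀ᶠ N in atTop, (sys N).IsStationary (π N))
    (hA0 : ∀ᶠ N in atTop, (sys N).arr 0 ≠ 0) (α : ℝ) (hα : 1 < α)
    (hload : ∀ᶠ N : ℕ+ in atTop, (sys N).lambdaSum = (sys N).muSum - (N : ℝ) ^ (1 - α))
    {γ c K : ℝ} (hreg : ∀ᶠ N : ℕ+ in atTop, (sys N).Regular γ c K) (k : ℕ) (σa νs : ℝ)
    (ha : ∀ᶠ N : ℕ+ in atTop, (sys N).arrVar = (N : ℝ) ^ k * σa ^ 2)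
    (hs : ∀ᶠ N : ℕ+ in atTop, (sys N).svcVar = (N : ℝ) ^ k * νs ^ 2) :
    0 < σa ^ 2 + νs ^ 2 ∧ ∀ r : ℝ, 2 ≤ r → ∃ C : ℝ, ∀ᶠ N : ℕ+ in atTop,
      wassersteinDist (scaledTotal (α - 1 + k) (π N)) (expMeasure (2 / (σa ^ 2 + νs ^ 2))) ≤
        ENNReal.ofReal (C * (N : ℝ) ^ (5 - k - α + (α - 1) / r)) := by
  have hpos : 0 < σa ^ 2 + νs ^ 2 := by
    obtain ⟨N, h0, H, ha⟩ := (hA0.and (hreg.and ha)).exists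
    have h1 := H.arrVar_ne_zero h0
    rw [ha] at h1
    have h2 : σa ≠ 0 := by
      rintro rfl
      simp at h1
    positivity
  refine ⟨hpos, fun r hr => ⟨rateConst K (σa ^ 2 + νs ^ 2) r, ?_⟩⟩
  filter_upwards [hπ, hload, hreg, ha, hs] with N hπ hload H ha hs
  refine H.wassersteinDist_le hπ hα hpos hr ?_ ?_
  · rw [System.slack, hload]; ring
  · rw [ha, hs]; ring

end LoadBalancing

end

open LoadBalancing in
theorem theorem1
    -- one system with `N` servers and one steady state of it for every `N ≥ 1`
    (sys : ∀ N : ℕ+, System N) (π : ∀ N : ℕ+, PMF (Fin N → ℕ))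
    (hπ : ∀ᶠ N in atTop, (sys N).IsStationary (π N))
    -- bounded supports and a positive probability of no arrival
    (Amax : ℕ+ → ℝ) (Smax : ℕ)
    (hA : ∀ᶠ N in atTop, ∀ a ∈ (sys N).arr.support, (a : ℝ) ≤ Amax N)
    (hS : ∀ᶠ N in atTop, ∀ s ∈ (sys N).svc.support, ∀ n, s n ≤ Smax)
    (hA0 : ∀ᶠ N in atTop, (sys N).arr 0 ≠ 0)
    -- the many-server heavy-traffic regime
    (α : ℝ) (hα : 1 < α)
    (hload : ∀ᶠ N : ℕ+ in atTop, (sys N).lambdaSum = (sys N).muSum - (N : ℝ) ^ (1 - α))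
    (hmu : (fun N : ℕ+ => (sys N).muSum) =Θ[atTop] fun N : ℕ+ => (N : ℝ))
    (hAmax : Amax =Θ[atTop] fun N : ℕ+ => (N : ℝ))
    -- the policies are in the flexible class
    (γ c : ℝ) (hγ0 : 0 < γ) (hγ1 : γ ≤ 1) (hc : 0 < c)
    (hclass : ∀ᶠ N : ℕ+ in atTop, (sys N).InFlexibleClass γ (c / (N : ℝ))) :
    -- the steady-state total queue length has a finite mean
    (∀ᶠ N in atTop, Integrable (fun Q => ∑ n, (Q n : ℝ)) (π N).toMeasure) ∧
    -- variances growing linearly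
    (∀ σa νs : ℝ,
      (∀ᶠ N : ℕ+ in atTop, (sys N).arrVar = (N : ℝ) * σa ^ 2) →
      (∀ᶠ N : ℕ+ in atTop, (sys N).svcVar = (N : ℝ) * νs ^ 2) →
      (∀ r : ℝ, 2 ≤ r → ∃ C : ℝ, ∀ᶠ N : ℕ+ in atTop,
        wassersteinDist (scaledTotal α (π N)) (expMeasure (2 / (σa ^ 2 + νs ^ 2))) ≤
          ENNReal.ofReal (C * (N : ℝ) ^ (4 - α + (α - 1) / r))) ∧
      (4 < α → ∀ f : BoundedContinuousFunction ℝ ℝ,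
        Tendsto (fun N : ℕ+ => ∫ x, f x ∂(scaledTotal α (π N))) atTop
          (𝓝 (∫ x, f x ∂(expMeasure (2 / (σa ^ 2 + νs ^ 2))))))) ∧
    -- variances growing quadratically
    (∀ σa νs : ℝ,
      (∀ᶠ N : ℕ+ in atTop, (sys N).arrVar = (N : ℝ) ^ 2 * σa ^ 2) →
      (∀ᶠ N : ℕ+ in atTop, (sys N).svcVar = (N : ℝ) ^ 2 * νs ^ 2) →
      (∀ r : ℝ, 2 ≤ r → ∃ C : ℝ, ∀ᶠ N : ℕ+ in atTop,
        wassersteinDist (scaledTotal (α + 1) (π N)) (expMeasure (2 / (σa ^ 2 + νs ^ 2))) ≤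
          ENNReal.ofReal (C * (N : ℝ) ^ (3 - α + (α - 1) / r))) ∧
      (3 < α → Tendsto (fun N : ℕ+ =>
        wassersteinDist (scaledTotal (α + 1) (π N)) (expMeasure (2 / (σa ^ 2 + νs ^ 2))))
          atTop (𝓝 0))) := by
  obtain ⟨K, hreg⟩ := exists_eventually_regular sys Amax Smax hA hS α hα hload hmu.2 hAmax.1 γ c
    hγ0 hγ1 hc hclass
  refine ⟨?_, fun σa νs ha hs => ?_, fun σa νs ha hs => ?_⟩
  · filter_upwards [hreg, hπ] with N H hπ
    exact H.integrable_total hπ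
  · obtain ⟨hpos, hW⟩ := exists_eventually_wassersteinDist_le sys π hπ hA0 α hα hload hreg 1 σa νs
      (by simpa only [pow_one] using ha) (by simpa only [pow_one] using hs)
    have e1 : α - 1 + ((1 : ℕ) : ℝ) = α := by push_cast; ring
    have e2 : 5 - ((1 : ℕ) : ℝ) - α = 4 - α := by push_cast; ring
    rw [e1, e2] at hW
    refine ⟨hW, fun hα4 f => ?_⟩
    have := isProbabilityMeasure_expMeasure (r := 2 / (σa ^ 2 + νs ^ 2)) (by positivity)
    obtain ⟨r, hr, hneg⟩ := exists_rate (a := α - 1) (b := 4 - α) (by linarith) (by linarith)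
    obtain ⟨C, hC⟩ := hW r hr
    refine tendsto_integral_of_wassersteinDist ?_ f
    exact tendsto_of_tendsto_of_tendsto_of_le_of_le' tendsto_const_nhds
      (tendsto_ofReal_mul_rpow C hneg) (Eventually.of_forall fun _ => zero_le) hC
  · obtain ⟨hpos, hW⟩ := exists_eventually_wassersteinDist_le sys π hπ hA0 α hα hload hreg 2 σa νs
      ha hs
    have e1 : α - 1 + ((2 : ℕ) : ℝ) = α + 1 := by push_cast; ring
    have e2 : 5 - ((2 : ℕ) : ℝ) - α = 3 - α := by push_cast; ring
    rw [e1, e2] at hW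
    refine ⟨hW, fun hα3 => ?_⟩
    obtain ⟨r, hr, hneg⟩ := exists_rate (a := α - 1) (b := 3 - α) (by linarith) (by linarith)
    obtain ⟨C, hC⟩ := hW r hr
    exact tendsto_of_tendsto_of_tendsto_of_le_of_le' tendsto_const_nhds
      (tendsto_ofReal_mul_rpow C hneg) (Eventually.of_forall fun _ => zero_le) hC
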